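/- Let $(M,\Delta)$ be a separable metric space with a Borel measure $\mathrm{vol}$ of intrinsic dimension $d\ge 1$ ($d$ an integer), in the sense that for some constant $\omega_d>0$ every closed ball of radius $r\ge 0$ has volume $\omega_d r^d$, so that a spherical shell with radii $s\le r$ has volume $\omega_d(r^d-s^d)$ (for example $\mathbb{R}^d$ with Lebesgue measure and the distance given by any norm). Let $\Phi$ be a homogeneous Poisson point process on $M$ with constant density $\rho>0$, that is, with intensity measure $\rho\cdot\mathrm{vol}$. For a point $x\in M$ let $r_{x,l}$ be the distance $\Delta$ between $x$ and its $l$-th nearest neighbour among the points of $\Phi$ other than $x$, and let $\mu_{x,l}=r_{x,l}/r_{x,l-1}$ for $l\ge 2$. Let $L\in\mathbb{N}$. Then $$\mu_{x,l}\sim \mathrm{Pareto}(1,(l-1)d)\qquad\text{for } l=2,\ldots,L,$$ where $\mathrm{Pareto}(1,a)$ has density $a\,y^{-a-1}$ on $(1,\infty)$, and $\mu_{x,2},\ldots,\mu_{x,L}$ are jointly independent. This holds (i) for every fixed $x\in M$, with respect to the law of $\Phi$; and (ii) for $x$ a typical observation, i.e. a typical point of $\Phi$ itself: for every Borel set $B\subseteq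 M$ with $0<\mathrm{vol}(B)<\infty$, the two assertions hold with respect to the Palm probabilities, in which the probability that $x$ has a property is the expected number of points $x\in\Phi\cap B$ having that property divided by the expected number of points of $\Phi$ in $B$. -/

import Mathlib

open MeasureTheory ProbabilityTheory
open scoped ENNReal NNReal

namespace NearestNeighbour

/-- `vol` is a volume measure of intrinsic dimension `d` for the distance of `M`: every ball of
radius `r` has volume `ω * r ^ d`, where `ω` is the volume of the balls of unit radius.
Equivalently, a spherical shell with radii `s ≤ r` has volume `ω * (r ^ d - s ^ d)`. -/
def HasBallVolume {M : Type*} [MetricSpace M] [MeasurableSpace M]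
    (vol : Measure M) (d : ℕ) (ω : ℝ) : Prop :=
  ∀ (x : M) (r : ℝ), 0 ≤ r → vol (Metric.closedBall x r) = ENNReal.ofReal (ω * r ^ d)

/-- Typical case: a `d`-dimensional real normed space with the distance of its norm and with
Lebesgue (Haar) measure. In particular `EuclideanSpace ℝ (Fin d)` with `volume`. -/
theorem hasBallVolume_of_normedSpace {E : Type*} [NormedAddCommGroup E] [NormedSpace ℝ E]
    [FiniteDimensional ℝ E] [MeasurableSpace E] [BorelSpace E]
    (vol : Measure E) [vol.IsAddHaarMeasure] :
    HasBallVolume vol (Module.finrank ℝ E) (vol.real (Metric.closedBall (0 : E) 1)) := by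
  intro x r hr
  rw [Measure.addHaar_closedBall' vol x hr, mul_comm (vol.real _),
    ENNReal.ofReal_mul (pow_nonneg hr _), measureReal_def,
    ENNReal.ofReal_toReal measure_closedBall_lt_top.ne]

/-- A Poisson point process on `M` with intensity measure `Λ`: a random countable subset `Φ` of
`M` whose counts in disjoint measurable sets are independent, the count in `B` being Poisson
distributed with mean `Λ B` (and almost surely infinite if `Λ B = ∞`). -/
structure IsPoissonProcess {Ω M : Type*} [MeasurableSpace Ω] [MeasurableSpace M]
    (Φ : Ω → Set M) (Λ : Measure M) (P : Measure Ω) : Prop where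
  countable : ∀ w, (Φ w).Countable
  measurable_count : ∀ B : Set M, MeasurableSet B → Measurable fun w => (Φ w ∩ B).encard
  law_count : ∀ B : Set M, MeasurableSet B → Λ B ≠ ∞ →
    P.map (fun w => (Φ w ∩ B).encard) =
      (poissonMeasure (Λ B).toNNReal).map (fun n : ℕ => (n : ℕ∞))
  count_eq_top : ∀ B : Set M, MeasurableSet B → Λ B = ∞ → ∀ᵐ w ∂P, (Φ w ∩ B).encard = ⊤
  indep_count : ∀ (n : ℕ) (B : Fin n → Set M), (∀ i, MeasurableSet (B i)) →
    Pairwise (Function.onFun Disjoint B) → iIndepFun (fun i w => (Φ w ∩ B i).encard) P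

/-- The distance `r_l` between `x` and its `l`-th nearest neighbour among the points of the
configuration `S` other than `x`: the smallest radius `r ≥ 0` such that the closed ball of radius
`r` around `x` holds at least `l` such points. In particular `r_0 = 0`. -/
noncomputable def nnDist {M : Type*} [MetricSpace M] (S : Set M) (x : M) (l : ℕ) : ℝ :=
  sInf {r : ℝ | 0 ≤ r ∧ (l : ℕ∞) ≤ ((S \ {x}) ∩ Metric.closedBall x r).encard}

/-- The ratio `μ_l = r_l / r_{l-1}` of consecutive nearest-neighbour distances of `x`
(used for `l ≥ 2`). -/
noncomputable def nnRatio {M : Type*} [MetricSpace M] (S : Set M) (x : M) (l : ℕ) : ℝ :=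
  nnDist S x l / nnDist S x (l - 1)

/-- The probability that a (typical) point `x` of the point process `Φ`, observed in the window
`B`, has the property `E (Φ w) x`: the mean number of points in `B` that have the property, divided
by the mean number of points in `B`. This is the Palm probability of `E`. -/
noncomputable def typicalPointProb {Ω M : Type*} [MeasurableSpace Ω]
    (P : Measure Ω) (Φ : Ω → Set M) (B : Set M) (E : Set M → M → Prop) : ℝ≥0∞ :=
  (∫⁻ w, ({x ∈ Φ w ∩ B | E (Φ w) x}.encard : ℝ≥0∞) ∂P) /
    (∫⁻ w, ((Φ w ∩ B).encard : ℝ≥0∞) ∂P)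

end NearestNeighbour

/-!
The process is a random element of the space `Config M` of configurations that are finite in balls,
whose counting measures form an s-finite kernel; this settles all questions of joint measurability.

The tool for both parts is Mecke's equation `IsPoissonProcess.mecke`: the mean number of points `z`
of the process `Φ` with a property of `(z, Φ \ {z})` is the integral over `z` of the probability
that `(z, Φ)` has the property. On rectangles `A × T`, with `T` an event about the counts in the
cells of a finite partition, it follows from the independence of the counts and from the identity
`E[N g(N - 1)] = λ E[g(N)]` for a Poisson variable `N` of mean `λ`. Such rectangles determine a
measure on `M × Config M`.

For a fixed `x` let `V(r)` be the mean number of points in the ball of radius `r`, and let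
`r_0 = 0`, `r_1`, `r_2`, … be the neighbour distances. Given constants `y_j ≥ 1`, the probability
that there are `k` points in the ball of radius `r`, that `r_{j+1} ≥ y_j r_j` for all `j < k`, and
that `r ≥ y_k r_k`, is `exp(-V(r)) V(r)^k / k! ∏_{j ≤ k} y_j^{-jd}`
(`IsPoissonProcess.measure_ballRatiosGe`). This is proved by induction on `k`: the point `z`
farthest from `x` is unique almost surely, so that the event is a sum over `z`, to which Mecke's
equation applies, and the measure of the balls turns the integral over `z` into an integral of
`v ^ k / k!`. The same summation, over the position of the `(k + 1)`-st neighbour, gives the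
joint tail `∏ y_j^{-jd}` of the ratios (`IsPoissonProcess.measure_ratiosGe`), which is
that of independent Pareto variables.

Around a typical point, Mecke's equation replaces the configuration without this point by the whole
process seen from a fixed location, where the probabilities do not depend on the location
(`IsPoissonProcess.typicalPointProb_eq`).
-/

namespace NearestNeighbour

/-! ### Configurations and their counting measures -/

section Configurations

variable {M : Type*} [MetricSpace M]

/-- Configurations: subsets of `M` with finitely many points in every ball. -/
structure Config (M : Type*) [MetricSpace M] where
  /-- The set of points. -/
  carrier : Set M
  finite_inter : ∀ x r, (carrier ∩ Metric.closedBall x r).Finite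

namespace Config

/-- The configuration with the point `z` removed. -/
def erase (S : Config M) (z : M) : Config M :=
  ⟨S.carrier \ {z}, fun x r => (S.finite_inter x r).subset (by gcongr; exact Set.sdiff_subset)⟩

theorem countable (S : Config M) : S.carrier.Countable := by
  rcases isEmpty_or_nonempty M with h | ⟨⟨x⟩⟩
  · exact Set.to_countable _
  · refine (Set.countable_iUnion fun n : ℕ => (S.finite_inter x n).countable).mono fun y hy => ?_
    obtain ⟨n, hn⟩ := exists_nat_ge (dist y x)
    exact Set.mem_iUnion.2 ⟨n, hy, hn⟩

variable [MeasurableSpace M]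

/-- The counting measure of a configuration. -/
noncomputable def counting (S : Config M) : Measure M := Measure.count.restrict S.carrier

/-- The σ-algebra generated by the numbers of points in measurable sets. -/
noncomputable instance : MeasurableSpace (Config M) := MeasurableSpace.comap counting inferInstance

/-- The counting measure of a configuration, as a kernel. -/
noncomputable def kernel (M : Type*) [MetricSpace M] [MeasurableSpace M] :
    Kernel (Config M) M :=
  ⟨counting, comap_measurable _⟩

theorem measurable_counting {B : Set M} (hB : MeasurableSet B) :
    Measurable fun S : Config M => S.counting B :=
  (Measure.measurable_coe hB).comp (comap_measurable _)

/-- A map into `Config M` is measurable as soon as the numbers of points in all measurable sets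
are. -/
theorem measurable_of_counting {α : Type*} [MeasurableSpace α] {f : α → Config M}
    (hf : ∀ B, MeasurableSet B → Measurable fun a => (f a).counting B) : Measurable f :=
  measurable_comap_iff.2 (Measure.measurable_of_measurable_coe _ hf)

variable [BorelSpace M]

theorem measurableSet (S : Config M) : MeasurableSet S.carrier := S.countable.measurableSet

theorem counting_apply (S : Config M) {B : Set M} (hB : MeasurableSet B) :
    S.counting B = ((S.carrier ∩ B).encard : ℝ≥0∞) := by
  rw [counting, Measure.restrict_apply hB, Measure.count_apply (hB.inter S.measurableSet),
    Set.inter_comm]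

theorem counting_erase (S : Config M) (z : M) {B : Set M} (hB : MeasurableSet B) :
    (S.erase z).counting B = S.counting (B \ {z}) := by
  rw [counting_apply _ hB, counting_apply _ (hB.diff (measurableSet_singleton z)), erase,
    ← Set.inter_sdiff_right_comm, Set.inter_sdiff_assoc]

theorem measurable_encard {B : Set M} (hB : MeasurableSet B) :
    Measurable fun S : Config M => (S.carrier ∩ B).encard := by
  refine measurable_to_countable' fun n => ?_
  have : (fun S : Config M => (S.carrier ∩ B).encard) ⁻¹' {n} =
      (fun S : Config M => S.counting B) ⁻¹' {(n : ℝ≥0∞)} := by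
    ext S; simp [counting_apply _ hB]
  rw [this]
  exact measurable_counting hB (measurableSet_singleton _)

instance : IsSFiniteKernel (kernel M) := by
  rcases isEmpty_or_nonempty M with h | ⟨⟨x⟩⟩
  · have : kernel M = 0 := by
      ext S B
      simp [Set.eq_empty_of_isEmpty B]
    rw [this]; infer_instance
  set U : ℕ → Set M := disjointed fun n : ℕ => Metric.closedBall x n with hUdef
  have hU : ∀ n, MeasurableSet (U n) :=
    fun n => MeasurableSet.disjointed (fun n => Metric.isClosed_closedBall.measurableSet) n
  have hUle : ∀ n, U n ⊆ Metric.closedBall x n := fun n => disjointed_subset _ n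
  have hUun : ⋃ n, U n = Set.univ := by
    rw [hUdef, iUnion_disjointed]
    exact Metric.iUnion_closedBall_nat x
  -- On each cell the kernel is a sum of bounded kernels, according to the number of points there.
  have hs : ∀ n m : ℕ, MeasurableSet {S : Config M | S.counting (U n) = m} :=
    fun n m => measurable_counting (hU n) (measurableSet_singleton _)
  classical
  have hcell : ∀ n, IsSFiniteKernel ((kernel M).restrict (hU n)) := by
    intro n
    have hfin : ∀ m : ℕ, IsFiniteKernel
        (Kernel.piecewise (hs n m) ((kernel M).restrict (hU n)) 0) := by
      refine fun m => ⟨m, ENNReal.natCast_lt_top m, fun S => ?_⟩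
      rw [Kernel.piecewise_apply]
      split_ifs with h
      · rw [Kernel.restrict_apply, Measure.restrict_apply_univ]
        exact le_of_eq h
      · simp
    have : (kernel M).restrict (hU n) = Kernel.sum fun m : ℕ =>
        Kernel.piecewise (hs n m) ((kernel M).restrict (hU n)) 0 := by
      ext S B hB
      obtain ⟨m, hm⟩ : ∃ m : ℕ, S.counting (U n) = m := by
        have hf : (S.carrier ∩ U n).Finite := (S.finite_inter x n).subset (by gcongr; exact hUle n)
        exact ⟨(S.carrier ∩ U n).ncard, by rw [counting_apply _ (hU n), ← hf.cast_ncard_eq]; simp⟩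
      rw [Kernel.sum_apply' _ _ hB, tsum_eq_single m]
      · simp [Kernel.piecewise_apply, hm]
      · intro m' hm'
        have : ¬ ((m : ℝ≥0∞) = m') := by exact_mod_cast hm'.symm
        simp [Kernel.piecewise_apply, hm, this]
    rw [this]
    infer_instance
  have : kernel M = Kernel.sum fun n => (kernel M).restrict (hU n) := by
    ext S B hB
    rw [Kernel.sum_apply' _ _ hB]
    simp_rw [Kernel.restrict_apply' _ _ _ hB]
    rw [← measure_iUnion _ fun n => hB.inter (hU n), ← Set.inter_iUnion, hUun, Set.inter_univ]
    exact fun i j hij => ((disjoint_disjointed _ hij).mono Set.inter_subset_right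
      Set.inter_subset_right)
  rw [this]
  infer_instance

/-- The number of points in a section of a measurable set is jointly measurable. -/
theorem measurable_counting_section {α : Type*} [MeasurableSpace α] {f : α → Config M}
    (hf : Measurable f) {t : Set (α × M)} (ht : MeasurableSet t) :
    Measurable fun a => (f a).counting (Prod.mk a ⁻¹' t) :=
  Kernel.measurable_kernel_prodMk_left (κ := (kernel M).comap f hf) ht

theorem measurable_erase [SecondCountableTopology M] :
    Measurable fun p : M × Config M => p.2.erase p.1 := by
  refine measurable_of_counting fun B hB => ?_
  have ht : MeasurableSet {q : (M × Config M) × M | q.2 ∈ B ∧ ¬ q.2 = q.1.1} :=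
    (measurable_snd hB).inter
      (measurableSet_eq_fun measurable_snd (measurable_fst.comp measurable_fst)).compl
  convert measurable_counting_section (measurable_snd (α := M) (β := Config M)) ht using 2 with p
  rw [counting_erase _ _ hB]
  rfl

end Config

end Configurations

/-! ### Mecke's equation -/

section Mecke

/-- Mecke's equation for the Poisson distribution. -/
theorem lintegral_nat_mul_poissonMeasure (r : ℝ≥0) (g : ℕ → ℝ≥0∞) :
    ∫⁻ n, n * g (n - 1) ∂(poissonMeasure r) = r * ∫⁻ n, g n ∂(poissonMeasure r) := by
  have h : ∀ f : ℕ → ℝ≥0∞, ∫⁻ n, f n ∂(poissonMeasure r) =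
      ∑' n : ℕ, ENNReal.ofReal (Real.exp (-r) * r ^ n / n.factorial) * f n := by
    intro f
    simp [poissonMeasure, lintegral_sum_measure, lintegral_smul_measure]
  rw [h, h, tsum_eq_zero_add' ENNReal.summable, ← ENNReal.tsum_mul_left]
  simp only [Nat.cast_zero, zero_mul, mul_zero, zero_add, Nat.add_sub_cancel]
  refine tsum_congr fun n => ?_
  rw [← mul_assoc, ← mul_assoc, ← ENNReal.ofReal_natCast, ← ENNReal.ofReal_coe_nnreal,
    ← ENNReal.ofReal_mul (by positivity), ← ENNReal.ofReal_mul (by positivity)]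
  congr 2
  rw [Nat.factorial_succ, pow_succ]
  push_cast
  field_simp

theorem lintegral_mul_map_poissonMeasure (r : ℝ≥0) (g : ℕ∞ → ℝ≥0∞) :
    ∫⁻ n, n * g (n - 1) ∂((poissonMeasure r).map (fun n : ℕ => (n : ℕ∞))) =
      r * ∫⁻ n, g n ∂((poissonMeasure r).map (fun n : ℕ => (n : ℕ∞))) := by
  rw [lintegral_map .of_discrete .of_discrete, lintegral_map .of_discrete .of_discrete,
    ← lintegral_nat_mul_poissonMeasure]
  simp

variable {M : Type*} [MetricSpace M] [MeasurableSpace M]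

namespace Config

/-- Events about the numbers of points in the cells of a finite measurable partition, given by the
fibres of a function. They form a π-system generating the σ-algebra of `Config M`. -/
def cylinders (M : Type*) [MetricSpace M] [MeasurableSpace M] : Set (Set (Config M)) :=
  {t | ∃ (n : ℕ) (f : M → Fin n) (T : Set (Fin n → ℝ≥0∞)), Measurable f ∧ MeasurableSet T ∧
    t = {S | (fun i => S.counting (f ⁻¹' {i})) ∈ T}}

theorem univ_mem_cylinders : Set.univ ∈ cylinders M :=
  ⟨1, fun _ => 0, Set.univ, measurable_const, .univ, by simp⟩

theorem isPiSystem_cylinders : IsPiSystem (cylinders M) := by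
  rintro _ ⟨n, f, T, hf, hT, rfl⟩ _ ⟨m, g, U, hg, hU, rfl⟩ -
  have hfg : Measurable fun x => finProdFinEquiv (f x, g x) :=
    (Measurable.of_discrete (f := finProdFinEquiv (m := n) (n := m))).comp (hf.prodMk hg)
  refine ⟨n * m, fun x => finProdFinEquiv (f x, g x),
    {v | (fun i => ∑ j, v (finProdFinEquiv (i, j))) ∈ T ∧
      (fun j => ∑ i, v (finProdFinEquiv (i, j))) ∈ U}, hfg, ?_, ?_⟩
  · refine MeasurableSet.inter (hT.preimage ?_) (hU.preimage ?_) <;> fun_prop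
  · have h1 : ∀ (S : Config M) (i : Fin n), ∑ j, S.counting
        ((fun x => finProdFinEquiv (f x, g x)) ⁻¹' {finProdFinEquiv (i, j)}) =
          S.counting (f ⁻¹' {i}) := by
      intro S i
      rw [← measure_biUnion_finset (fun j _ k _ hjk => ?_)
        fun j _ => hfg (measurableSet_singleton _)]
      · congr 1; ext x; simp
      · refine Disjoint.preimage _ ?_
        simpa using hjk
    have h2 : ∀ (S : Config M) (j : Fin m), ∑ i, S.counting
        ((fun x => finProdFinEquiv (f x, g x)) ⁻¹' {finProdFinEquiv (i, j)}) =
          S.counting (g ⁻¹' {j}) := by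
      intro S i
      rw [← measure_biUnion_finset (fun j _ k _ hjk => ?_)
        fun j _ => hfg (measurableSet_singleton _)]
      · congr 1; ext x; simp
      · refine Disjoint.preimage _ ?_
        simpa using hjk
    ext S
    simp only [Set.mem_inter_iff, Set.mem_ofPred_eq, h1, h2]

theorem generateFrom_cylinders :
    MeasurableSpace.generateFrom (cylinders M) = (inferInstance : MeasurableSpace (Config M)) := by
  refine le_antisymm (MeasurableSpace.generateFrom_le ?_) ?_
  · rintro _ ⟨n, f, T, hf, hT, rfl⟩
    exact (measurable_pi_lambda _ fun i =>
      measurable_counting (hf (measurableSet_singleton i))) hT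
  · refine measurable_iff_comap_le.1 (Measure.measurable_of_measurable_coe _ fun B hB U hU => ?_)
    classical
    refine MeasurableSpace.measurableSet_generateFrom ⟨2, fun x => if x ∈ B then 1 else 0,
      {v | v 1 ∈ U}, Measurable.ite hB measurable_const measurable_const,
      measurable_pi_apply 1 hU, ?_⟩
    ext S
    have : (fun x => if x ∈ B then (1 : Fin 2) else 0) ⁻¹' {1} = B := by ext x; simp
    simp [this]

end Config

variable [BorelSpace M] {Ω : Type*} [MeasurableSpace Ω] {P : Measure Ω} [IsProbabilityMeasure P]
  {Λ : Measure M} {Ψ : Ω → Config M}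

/-- Mecke's equation for a cell `A` of finite intensity, contained in a cell of the partition. The
number of points in `A` is independent of the rest of the process, so that the equation reduces to
the one for the Poisson distribution. -/
theorem IsPoissonProcess.mecke_cell (hΨ : Measurable Ψ)
    (h : IsPoissonProcess (fun w => (Ψ w).carrier) Λ P) {A : Set M} (hA : MeasurableSet A)
    (hΛ : Λ A ≠ ∞) {n : ℕ} {f : M → Fin n} (hf : Measurable f) {a : Fin n} (ha : A ⊆ f ⁻¹' {a})
    {T : Set (Fin n → ℝ≥0∞)} (hT : MeasurableSet T) :
    ∫⁻ w, (Ψ w).counting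
        {z | z ∈ A ∧ (fun i => ((Ψ w).erase z).counting (f ⁻¹' {i})) ∈ T} ∂P =
      Λ A * P {w | (fun i => (Ψ w).counting (f ⁻¹' {i})) ∈ T} := by
  have hfi : ∀ i, MeasurableSet (f ⁻¹' {i}) := fun i => hf (measurableSet_singleton i)
  set D : Fin n → Set M := fun i => f ⁻¹' {i} \ A
  have hD : ∀ i, MeasurableSet (D i) := fun i => (hfi i).diff hA
  set N : Ω → ℕ∞ := fun w => ((Ψ w).carrier ∩ A).encard
  set R : Ω → Fin n → ℕ∞ := fun w i => ((Ψ w).carrier ∩ D i).encard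
  have hN : Measurable N := (Config.measurable_encard hA).comp hΨ
  have hR : Measurable R := measurable_pi_lambda _ fun i =>
    (Config.measurable_encard (hD i)).comp hΨ
  have hind : IndepFun N R P := by
    have hAD : ∀ i, MeasurableSet ((Fin.cons A D : Fin (n + 1) → Set M) i) := by
      intro i
      induction i using Fin.cases
      exacts [hA, hD _]
    have hB := h.indep_count (n + 1) (Fin.cons A D) hAD ?_
    · have := hB.indepFun_finset {0} (Finset.univ.image Fin.succ) (by simp)
        fun i => (Config.measurable_encard (hAD i)).comp hΨ
      exact this.comp
        (φ := fun v : ({0} : Finset (Fin (n + 1))) → ℕ∞ => v ⟨0, by simp⟩)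
        (ψ := fun (v : ↥(Finset.univ.image Fin.succ : Finset (Fin (n + 1))) → ℕ∞) (i : Fin n) =>
          v ⟨i.succ, by simp⟩)
        (by fun_prop) (by fun_prop)
    · intro i j hij
      induction i using Fin.cases <;> induction j using Fin.cases
      · exact absurd rfl hij
      · exact Set.disjoint_sdiff_right
      · exact Set.disjoint_sdiff_left
      · rename_i i j
        have hij : i ≠ j := fun e => hij (by rw [e])
        exact ((Set.disjoint_singleton.2 hij).preimage f).mono Set.sdiff_subset Set.sdiff_subset
  -- The counts of the partition, from the count in `A` and those in the cells without `A`.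
  set F : ℕ∞ → (Fin n → ℕ∞) → Fin n → ℝ≥0∞ := fun m v i =>
    (v i : ℝ≥0∞) + if i = a then (m : ℝ≥0∞) else 0
  have hF : ∀ w, (fun i => (Ψ w).counting (f ⁻¹' {i})) = F (N w) (R w) := by
    intro w
    ext i
    simp only [F, N, R]
    rw [← Config.counting_apply _ hA, ← Config.counting_apply _ (hD i),
      ← measure_inter_add_sdiff (f ⁻¹' {i}) hA, add_comm]
    congr 1
    split_ifs with hi
    · rw [hi, Set.inter_eq_right.2 ha]
    · rw [Set.disjoint_iff_inter_eq_empty.1, measure_empty]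
      exact ((Set.disjoint_singleton.2 hi).preimage f).mono_right ha
  have hF' : ∀ w, ∀ z ∈ (Ψ w).carrier ∩ A,
      (fun i => ((Ψ w).erase z).counting (f ⁻¹' {i})) = F (N w - 1) (R w) := by
    intro w z hz
    ext i
    have hAz : MeasurableSet ({z} : Set M) := measurableSet_singleton z
    have hz1 : ((Ψ w).counting (A \ {z})) = ((N w - 1 : ℕ∞) : ℝ≥0∞) := by
      rw [Config.counting_apply _ (hA.diff hAz), ← Set.inter_sdiff_assoc,
        Set.encard_sdiff_singleton_of_mem hz]
    simp only [F, R]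
    rw [Config.counting_erase _ _ (hfi i), ← hz1, ← Config.counting_apply _ (hD i),
      ← measure_inter_add_sdiff (f ⁻¹' {i} \ {z}) hA, add_comm]
    congr 1
    · congr 1
      ext y
      simp only [D, Set.mem_sdiff, Set.mem_singleton_iff]
      exact ⟨fun hy => ⟨hy.1.1, hy.2⟩, fun hy => ⟨⟨hy.1, fun e => hy.2 (e ▸ hz.2)⟩, hy.2⟩⟩
    split_ifs with hi
    · rw [hi, ← Set.inter_sdiff_right_comm, Set.inter_eq_right.2 ha]
    · rw [Set.disjoint_iff_inter_eq_empty.1, measure_empty]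
      exact (((Set.disjoint_singleton.2 hi).preimage f).mono_right ha).mono_left Set.sdiff_subset
  set G : ℕ∞ → (Fin n → ℕ∞) → ℝ≥0∞ := fun m v => T.indicator 1 (F m v)
  have hF_meas : Measurable (Function.uncurry F) := by
    refine measurable_pi_lambda _ fun i => ?_
    simp only [F, Function.uncurry]
    refine Measurable.add ?_ ?_
    · exact (Measurable.of_discrete (f := fun m : ℕ∞ => (m : ℝ≥0∞))).comp
        ((measurable_pi_apply i).comp measurable_snd)
    · split_ifs
      · exact (Measurable.of_discrete (f := fun m : ℕ∞ => (m : ℝ≥0∞))).comp measurable_fst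
      · exact measurable_const
  have hG : Measurable (Function.uncurry G) :=
    (measurable_one.indicator hT).comp hF_meas
  have hL : ∀ w, (Ψ w).counting
      {z | z ∈ A ∧ (fun i => ((Ψ w).erase z).counting (f ⁻¹' {i})) ∈ T} =
        (N w : ℝ≥0∞) * G (N w - 1) (R w) := by
    intro w
    by_cases hw : F (N w - 1) (R w) ∈ T
    · have hG1 : G (N w - 1) (R w) = 1 := by simp [G, hw]
      rw [hG1, mul_one, ← Config.counting_apply _ hA, Config.counting,
        Measure.restrict_apply' (Ψ w).measurableSet, Measure.restrict_apply' (Ψ w).measurableSet]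
      congr 1
      ext z
      exact ⟨fun hz => ⟨hz.1.1, hz.2⟩, fun hz => ⟨⟨hz.1, by rwa [hF' w z hz.symm]⟩, hz.2⟩⟩
    · have hG0 : G (N w - 1) (R w) = 0 := by simp [G, hw]
      rw [hG0, mul_zero, Config.counting, Measure.restrict_apply' (Ψ w).measurableSet]
      refine measure_mono_null (t := ∅) (fun z hz => hw ?_) measure_empty
      rw [← hF' w z ⟨hz.2, hz.1.1⟩]
      exact hz.1.2
  have hlaw : ∀ g : ℕ∞ → (Fin n → ℕ∞) → ℝ≥0∞, Measurable (Function.uncurry g) →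
      ∫⁻ w, g (N w) (R w) ∂P = ∫⁻ v, ∫⁻ m, g m v ∂(P.map N) ∂(P.map R) := by
    intro g hg
    have h1 := (indepFun_iff_map_prod_eq_prod_map_map hN.aemeasurable hR.aemeasurable).1 hind
    have : IsProbabilityMeasure (P.map N) := Measure.isProbabilityMeasure_map hN.aemeasurable
    have : IsProbabilityMeasure (P.map R) := Measure.isProbabilityMeasure_map hR.aemeasurable
    have h2 := lintegral_prod_symm' (μ := P.map N) (ν := P.map R) (Function.uncurry g) hg
    rw [← h1, lintegral_map hg (hN.prodMk hR)] at h2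
    exact h2
  have hG' : Measurable (Function.uncurry fun (m : ℕ∞) v => (m : ℝ≥0∞) * G (m - 1) v) :=
    ((Measurable.of_discrete (f := fun m : ℕ∞ => (m : ℝ≥0∞))).comp measurable_fst).mul
      (hG.comp (((Measurable.of_discrete (f := fun m : ℕ∞ => m - 1)).comp
        measurable_fst).prodMk measurable_snd))
  have hN' : P.map N = _ := h.law_count A hA hΛ
  have hR2 : P {w | (fun i => (Ψ w).counting (f ⁻¹' {i})) ∈ T} = ∫⁻ w, G (N w) (R w) ∂P := by
    simp_rw [hF]
    exact (lintegral_indicator_one ((hF_meas.comp (hN.prodMk hR)) hT)).symm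
  rw [lintegral_congr hL]
  rw [hR2, hlaw (fun m v => (m : ℝ≥0∞) * G (m - 1) v) hG', hlaw G hG, hN']
  rw [lintegral_congr fun v => lintegral_mul_map_poissonMeasure (Λ A).toNNReal fun m => G m v]
  rw [lintegral_const_mul', ENNReal.coe_toNNReal hΛ]
  · exact ENNReal.coe_ne_top

variable [SecondCountableTopology M]

theorem measurable_erase_pair (hΨ : Measurable Ψ) :
    Measurable fun p : Ω × M => (p.2, (Ψ p.1).erase p.2) :=
  measurable_snd.prodMk
    (Config.measurable_erase.comp (measurable_snd.prodMk (hΨ.comp measurable_fst)))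

/-- The map in question sends a point `z` of the process to the pair of `z` and the configuration of
the other points, so that this is the mean number of points with the property `t`. -/
theorem compProd_erase_apply (hΨ : Measurable Ψ) {t : Set (M × Config M)}
    (ht : MeasurableSet t) :
    ((P ⊗ₘ ((Config.kernel M).comap Ψ hΨ)).map fun p => (p.2, (Ψ p.1).erase p.2)) t =
      ∫⁻ w, (Ψ w).counting {z | (z, (Ψ w).erase z) ∈ t} ∂P := by
  rw [Measure.map_apply (measurable_erase_pair hΨ) ht,
    Measure.compProd_apply (measurable_erase_pair hΨ ht)]
  rfl

variable [SigmaFinite Λ]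

/-- Mecke's equation, as an equality of measures: choosing a point `z` of the process and removing
it leaves an independent copy of the process. -/
theorem IsPoissonProcess.mecke_measure (hΨ : Measurable Ψ)
    (h : IsPoissonProcess (fun w => (Ψ w).carrier) Λ P) :
    Λ.prod (P.map Ψ) = (P ⊗ₘ ((Config.kernel M).comap Ψ hΨ)).map
      fun p => (p.2, (Ψ p.1).erase p.2) := by
  have : IsProbabilityMeasure (P.map Ψ) := Measure.isProbabilityMeasure_map hΨ.aemeasurable
  refine Measure.prod_eq_generateFrom (C := {s | MeasurableSet s})
    (MeasurableSpace.generateFrom_measurableSet) Config.generateFrom_cylinders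
    MeasurableSpace.isPiSystem_measurableSet Config.isPiSystem_cylinders
    Λ.toFiniteSpanningSetsIn ⟨fun _ => Set.univ, fun _ => Config.univ_mem_cylinders,
      fun _ => measure_lt_top _ _, Set.iUnion_const _⟩ ?_
  rintro A hA t ⟨n, f, T, hf, hT, rfl⟩
  have ht : MeasurableSet {S : Config M | (fun i => S.counting (f ⁻¹' {i})) ∈ T} :=
    (measurable_pi_lambda _ fun i =>
      Config.measurable_counting (hf (measurableSet_singleton i))) hT
  set ν := (P ⊗ₘ ((Config.kernel M).comap Ψ hΨ)).map fun p => (p.2, (Ψ p.1).erase p.2)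
  set t := {S : Config M | (fun i => S.counting (f ⁻¹' {i})) ∈ T}
  suffices hs : (ν.restrict (Set.univ ×ˢ t)).map Prod.fst = (P.map Ψ t) • Λ by
    have := congrArg (fun m => m A) hs
    simp only [Measure.smul_apply, smul_eq_mul] at this
    rw [Measure.map_apply measurable_fst hA, Measure.restrict_apply (measurable_fst hA)] at this
    rw [mul_comm, ← this]
    congr 1
    ext p; simp
  -- It suffices to consider subsets `A` of finite intensity inside a cell of the partition.
  refine (Measure.ext_iff_of_iUnion_eq_univ
    (s := fun q : ℕ × Fin n => spanningSets Λ q.1 ∩ f ⁻¹' {q.2}) ?_).2 ?_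
  rotate_left
  · rintro ⟨k, i⟩
    ext A hA
    have hB : MeasurableSet (A ∩ (spanningSets Λ k ∩ f ⁻¹' {i})) :=
      hA.inter ((measurableSet_spanningSets Λ k).inter (hf (measurableSet_singleton i)))
    rw [Measure.restrict_apply hA, Measure.restrict_apply hA, Measure.map_apply measurable_fst hB,
      Measure.restrict_apply (measurable_fst hB), compProd_erase_apply hΨ ((measurable_fst hB).inter
        (MeasurableSet.univ.prod ht)), Measure.smul_apply, smul_eq_mul, mul_comm,
        Measure.map_apply hΨ ht]
    refine Eq.trans ?_ (h.mecke_cell hΨ hB ?_ hf (a := i) ?_ hT)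
    · refine lintegral_congr fun w => ?_
      congr 1
      ext z
      simp [t]
    · exact ((measure_mono (Set.inter_subset_right.trans Set.inter_subset_left)).trans_lt
        (measure_spanningSets_lt_top Λ k)).ne
    · exact Set.inter_subset_right.trans Set.inter_subset_right
  · ext x
    simpa using Set.mem_iUnion.1 ((iUnion_spanningSets Λ).symm ▸ Set.mem_univ x)

/-- Mecke's equation for a property `t` of a point and of the remaining configuration. -/
theorem IsPoissonProcess.mecke (hΨ : Measurable Ψ)
    (h : IsPoissonProcess (fun w => (Ψ w).carrier) Λ P) {t : Set (M × Config M)}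
    (ht : MeasurableSet t) :
    ∫⁻ w, (Ψ w).counting {z | (z, (Ψ w).erase z) ∈ t} ∂P = ∫⁻ z, P {w | (z, Ψ w) ∈ t} ∂Λ := by
  have : IsProbabilityMeasure (P.map Ψ) := Measure.isProbabilityMeasure_map hΨ.aemeasurable
  rw [← compProd_erase_apply hΨ ht, ← h.mecke_measure hΨ, Measure.prod_apply ht]
  refine lintegral_congr fun z => ?_
  rw [Measure.map_apply hΨ (measurable_prodMk_left ht)]
  rfl

theorem IsPoissonProcess.lintegral_counting (hΨ : Measurable Ψ)
    (h : IsPoissonProcess (fun w => (Ψ w).carrier) Λ P) {B : Set M} (hB : MeasurableSet B) :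
    ∫⁻ w, (Ψ w).counting B ∂P = Λ B := by
  have := h.mecke hΨ (measurable_fst hB)
  refine this.trans ?_
  rw [← lintegral_indicator_one hB]
  refine lintegral_congr fun z => ?_
  by_cases hz : z ∈ B <;> simp [hz]

end Mecke

/-! ### Neighbours in a generic configuration -/

section Neighbours

variable {M : Type*} [MetricSpace M] {S : Set M} {x z : M} {k : ℕ}

theorem nnDist_nonneg (S : Set M) (x : M) (l : ℕ) : 0 ≤ nnDist S x l :=
  Real.sInf_nonneg fun _ hr => hr.1

theorem nnDist_zero (S : Set M) (x : M) : nnDist S x 0 = 0 := by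
  have : {r : ℝ | 0 ≤ r ∧ ((0 : ℕ) : ℕ∞) ≤ ((S \ {x}) ∩ Metric.closedBall x r).encard} =
      Set.Ici 0 := by
    ext r; simp
  rw [nnDist, this, csInf_Ici]

/-- The points of `S` in the closed ball of radius `r` around `x`, other than `x`. -/
noncomputable def ballCount (S : Set M) (x : M) (r : ℝ) : ℕ∞ :=
  ((S \ {x}) ∩ Metric.closedBall x r).encard

theorem ballCount_mono (S : Set M) (x : M) : Monotone (ballCount S x) := fun _ _ h =>
  Set.encard_le_encard (Set.inter_subset_inter_right _ (Metric.closedBall_subset_closedBall h))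

theorem ballCount_eq_add_one (hz : z ∈ S) (hzx : z ≠ x) {r : ℝ} (hr : dist z x ≤ r) :
    ballCount S x r = ballCount (S \ {z}) x r + 1 := by
  rw [ballCount, ballCount, ← Set.encard_insert_of_notMem (a := z)]
  · congr 1
    ext y
    by_cases hy : y = z
    · subst hy; simp [hz, hzx, hr]
    · simp [hy]
  · simp

theorem ballCount_sdiff_of_lt {r : ℝ} (hr : r < dist z x) :
    ballCount (S \ {z}) x r = ballCount S x r := by
  rw [ballCount, ballCount]
  congr 1
  ext y
  by_cases hy : y = z
  · subst hy; simp [hr]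
  · simp [hy]

/-- `z` is a nearest neighbour of `x` in `S` of order `k + 1`: exactly `k` other neighbours are
at most as far from `x` as `z`. -/
def IsNeighbour (S : Set M) (x : M) (k : ℕ) (z : M) : Prop :=
  z ∈ S ∧ z ≠ x ∧ ballCount (S \ {z}) x (dist z x) = k

/-- The removal of the neighbour of order `k + 1` does not change the first `k` distances. -/
theorem IsNeighbour.nnDist_sdiff (h : IsNeighbour S x k z) {j : ℕ} (hj : j ≤ k) :
    nnDist (S \ {z}) x j = nnDist S x j := by
  have hj' : (j : ℕ∞) ≤ k := by exact_mod_cast hj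
  rw [nnDist, nnDist]
  congr 1
  ext r
  refine and_congr_right fun _ => ?_
  change (j : ℕ∞) ≤ ballCount (S \ {z}) x r ↔ (j : ℕ∞) ≤ ballCount S x r
  rcases lt_or_ge r (dist z x) with hr | hr
  · rw [ballCount_sdiff_of_lt hr]
  · have h1 : (j : ℕ∞) ≤ ballCount (S \ {z}) x r :=
      hj'.trans (h.2.2.symm.le.trans (ballCount_mono _ _ hr))
    rw [ballCount_eq_add_one h.1 h.2.1 hr]
    exact iff_of_true h1 (h1.trans le_self_add)

theorem IsNeighbour.nnDist_succ (h : IsNeighbour S x k z) : nnDist S x (k + 1) = dist z x := by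
  have : {r : ℝ | 0 ≤ r ∧ ((k + 1 : ℕ) : ℕ∞) ≤ ((S \ {x}) ∩ Metric.closedBall x r).encard} =
      Set.Ici (dist z x) := by
    ext r
    change (0 ≤ r ∧ ((k + 1 : ℕ) : ℕ∞) ≤ ballCount S x r) ↔ dist z x ≤ r
    refine ⟨fun hr => ?_, fun hr => ⟨dist_nonneg.trans hr, ?_⟩⟩
    · by_contra! hlt
      have h1 : ballCount S x r ≤ k := by
        rw [← ballCount_sdiff_of_lt hlt, ← h.2.2]
        exact ballCount_mono _ _ hlt.le
      have h2 := hr.2.trans h1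
      norm_cast at h2
      omega
    · rw [ballCount_eq_add_one h.1 h.2.1 hr]
      push_cast
      gcongr
      exact h.2.2.symm.le.trans (ballCount_mono _ _ hr)
  rw [nnDist, this, csInf_Ici]

/-- An infinite configuration, finite in balls, such that no two of its points have the same
distance to `x`. -/
structure IsGeneric (S : Set M) (x : M) : Prop where
  finite_inter : ∀ r, (S ∩ Metric.closedBall x r).Finite
  infinite : S.Infinite
  eq_of_dist_eq : ∀ z ∈ S, ∀ z' ∈ S, dist z x = dist z' x → z = z'

theorem IsGeneric.exists_nearest (h : IsGeneric S x) (T : Finset M) :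
    ∃ z ∈ (S \ {x}) \ (T : Set M), ∀ b ∈ (S \ {x}) \ (T : Set M), b ≠ z →
      dist z x < dist b x := by
  obtain ⟨c, hc⟩ := ((h.infinite.sdiff (Set.finite_singleton x)).sdiff T.finite_toSet).nonempty
  have hfin : (((S \ {x}) \ (T : Set M)) ∩ Metric.closedBall x (dist c x)).Finite :=
    (h.finite_inter (dist c x)).subset
      (Set.inter_subset_inter_left _ (Set.sdiff_subset.trans Set.sdiff_subset))
  obtain ⟨z, hz, hmin⟩ := Set.exists_min_image _ (fun y => dist y x) hfin
    ⟨c, hc, Metric.mem_closedBall.2 le_rfl⟩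
  refine ⟨z, hz.1, fun b hb hbz => lt_of_le_of_ne ?_ fun e =>
    hbz (h.eq_of_dist_eq z hz.1.1.1 b hb.1.1 e).symm⟩
  rcases le_total (dist b x) (dist c x) with hbc | hbc
  · exact hmin b ⟨hb, hbc⟩
  · exact (Metric.mem_closedBall.1 hz.2).trans hbc

/-- The `k` nearest neighbours of `x` exist. -/
theorem IsGeneric.exists_initial (h : IsGeneric S x) (k : ℕ) :
    ∃ T : Finset M, T.card = k ∧ (T : Set M) ⊆ S \ {x} ∧
      ∀ a ∈ T, ∀ b ∈ (S \ {x}) \ (T : Set M), dist a x < dist b x := by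
  classical
  induction k with
  | zero => exact ⟨∅, by simp⟩
  | succ k ih =>
    obtain ⟨T, hT, hTS, hlt⟩ := ih
    obtain ⟨z, hz, hmin⟩ := h.exists_nearest T
    refine ⟨insert z T, ?_, ?_, ?_⟩
    · rw [Finset.card_insert_of_notMem (by simpa using hz.2), hT]
    · rw [Finset.coe_insert]
      exact Set.insert_subset hz.1 hTS
    · intro a ha b hb
      have hb' : b ∈ (S \ {x}) \ (T : Set M) := ⟨hb.1, fun hbT => hb.2 (by simp_all)⟩
      rcases Finset.mem_insert.1 ha with rfl | ha
      · exact hmin b hb' fun e => hb.2 (by simp [e])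
      · exact hlt a ha b hb'

theorem IsGeneric.exists_isNeighbour (h : IsGeneric S x) (k : ℕ) : ∃ z, IsNeighbour S x k z := by
  obtain ⟨T, hT, hTS, hlt⟩ := h.exists_initial k
  obtain ⟨z, hz, hmin⟩ := h.exists_nearest T
  refine ⟨z, hz.1.1, hz.1.2, ?_⟩
  rw [ballCount, ← hT, ← Set.encard_coe_eq_coe_finsetCard]
  congr 1
  ext y
  constructor
  · rintro ⟨⟨⟨hyS, hyz⟩, hyx⟩, hy⟩
    by_contra hyT
    exact (hmin y ⟨⟨hyS, hyx⟩, hyT⟩ hyz).not_ge hy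
  · intro hy
    exact ⟨⟨⟨(hTS hy).1, fun e => hz.2 (e ▸ hy)⟩, (hTS hy).2⟩, (hlt y hy z hz).le⟩

theorem IsGeneric.isNeighbour_unique (h : IsGeneric S x) {z' : M} (hz : IsNeighbour S x k z)
    (hz' : IsNeighbour S x k z') : z = z' :=
  h.eq_of_dist_eq z hz.1 z' hz'.1 (hz.nnDist_succ.symm.trans hz'.nnDist_succ)

theorem IsGeneric.nnDist_pos (h : IsGeneric S x) (k : ℕ) : 0 < nnDist S x (k + 1) := by
  obtain ⟨z, hz⟩ := h.exists_isNeighbour k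
  rw [hz.nnDist_succ]
  exact dist_pos.2 hz.2.1

theorem IsGeneric.nnDist_le_succ (h : IsGeneric S x) (k : ℕ) :
    nnDist S x k ≤ nnDist S x (k + 1) := by
  obtain ⟨z, hz⟩ := h.exists_isNeighbour k
  have hk : ((k + 1 : ℕ) : ℕ∞) ≤ ((S \ {x}) ∩ Metric.closedBall x (dist z x)).encard := by
    change _ ≤ ballCount S x (dist z x)
    rw [ballCount_eq_add_one hz.1 hz.2.1 le_rfl, hz.2.2]
    norm_cast
  refine csInf_le_csInf ⟨0, fun r hr => hr.1⟩ ⟨dist z x, dist_nonneg, hk⟩ fun r hr => ⟨hr.1, ?_⟩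
  exact le_trans (by norm_cast; omega) hr.2

/-- The first `n` ratios `r_{j+1} / r_j` of neighbour distances are at least `y j`. -/
def RatiosGe (y : ℕ → ℝ) (S : Set M) (x : M) (n : ℕ) : Prop :=
  ∀ j < n, y j * nnDist S x j ≤ nnDist S x (j + 1)

theorem ratiosGe_succ {y : ℕ → ℝ} :
    RatiosGe y S x (k + 1) ↔ RatiosGe y S x k ∧ y k * nnDist S x k ≤ nnDist S x (k + 1) :=
  Nat.forall_lt_succ_right

/-- There are exactly `k` neighbours up to the distance `r` and also up to the distance `R`, their
consecutive distances have ratios at least `y j`, and `r` is at least `y k` times the largest of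
them. The second radius `R ≥ r` stays fixed in the recursion on `k`, so that the independence of the
parts of the process inside and outside a random ball is not needed. -/
def BallRatiosGe (y : ℕ → ℝ) (x : M) (k : ℕ) (S : Set M) (r R : ℝ) : Prop :=
  ballCount S x r = k ∧ ballCount S x R = k ∧ RatiosGe y S x k ∧ y k * nnDist S x k ≤ r

/-- The condition on the first `k + 1` ratios, in terms of the neighbour `z` of order `k + 1` and of
the configuration without `z`. -/
theorem IsNeighbour.ratiosGe_succ_iff {y : ℕ → ℝ} (h : IsNeighbour S x k z) :
    RatiosGe y S x (k + 1) ↔ RatiosGe y (S \ {z}) x k ∧ y k * nnDist (S \ {z}) x k ≤ dist z x := by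
  rw [ratiosGe_succ, h.nnDist_succ, h.nnDist_sdiff le_rfl]
  refine and_congr_left fun _ => forall₂_congr fun j hj => ?_
  rw [h.nnDist_sdiff hj.le, h.nnDist_sdiff hj]

/-- The condition on the ratios as a sum over the points of `S`: the only contribution is that of
the neighbour of order `k + 1`. -/
theorem IsGeneric.encard_ratiosGe (h : IsGeneric S x) (y : ℕ → ℝ) (k : ℕ)
    [Decidable (RatiosGe y S x (k + 1))] :
    {z ∈ S | z ≠ x ∧ BallRatiosGe y x k (S \ {z}) (dist z x) (dist z x)}.encard =
      if RatiosGe y S x (k + 1) then 1 else 0 := by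
  split_ifs with hy
  · obtain ⟨z, hz⟩ := h.exists_isNeighbour k
    rw [Set.encard_eq_one]
    refine ⟨z, Set.eq_singleton_iff_unique_mem.2 ⟨⟨hz.1, hz.2.1, hz.2.2, hz.2.2,
      hz.ratiosGe_succ_iff.1 hy⟩, fun z' hz' => ?_⟩⟩
    exact h.isNeighbour_unique ⟨hz'.1, hz'.2.1, hz'.2.2.1⟩ hz
  · rw [Set.encard_eq_zero, Set.eq_empty_iff_forall_notMem]
    rintro z ⟨hz, hzx, hb⟩
    exact hy ((IsNeighbour.ratiosGe_succ_iff ⟨hz, hzx, hb.1⟩).2 hb.2.2)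

/-- The condition on the ratios in a ball as a sum over the points of `S`, with the farthest of the
`k + 1` neighbours in the ball as the only contribution. -/
theorem IsGeneric.encard_ballRatiosGe (h : IsGeneric S x) {y : ℕ → ℝ} {k : ℕ}
    (hy : 1 ≤ y (k + 1)) {r R : ℝ} (hrR : r ≤ R) [Decidable (BallRatiosGe y x (k + 1) S r R)] :
    {z ∈ S | z ≠ x ∧ y (k + 1) * dist z x ≤ r ∧
      BallRatiosGe y x k (S \ {z}) (dist z x) R}.encard =
      if BallRatiosGe y x (k + 1) S r R then 1 else 0 := by
  have key : ∀ z, IsNeighbour S x k z → (BallRatiosGe y x (k + 1) S r R ↔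
      y (k + 1) * dist z x ≤ r ∧ BallRatiosGe y x k (S \ {z}) (dist z x) R) := by
    intro z hz
    have hle : y (k + 1) * dist z x ≤ r → dist z x ≤ r := fun h' =>
      (le_mul_of_one_le_left dist_nonneg hy).trans h'
    have hinj : ∀ {r'}, dist z x ≤ r' →
        (ballCount S x r' = ((k + 1 : ℕ) : ℕ∞) ↔ ballCount (S \ {z}) x r' = k) := by
      intro r' hr'
      rw [ballCount_eq_add_one hz.1 hz.2.1 hr']
      push_cast
      exact ENat.add_left_injective_of_ne_top (by simp) |>.eq_iff
    rw [BallRatiosGe, hz.ratiosGe_succ_iff, hz.nnDist_succ]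
    constructor
    · rintro ⟨h1, h2, h3, h4⟩
      exact ⟨h4, hz.2.2, (hinj ((hle h4).trans hrR)).1 h2, h3⟩
    · rintro ⟨h4, h1, h2, h3⟩
      refine ⟨(hinj (hle h4)).2 (le_antisymm ?_ ?_), (hinj ((hle h4).trans hrR)).2 h2, h3, h4⟩
      · rw [← h2]; exact ballCount_mono _ _ hrR
      · rw [← h1]; exact ballCount_mono _ _ (hle h4)
  split_ifs with hb
  · obtain ⟨z, hz⟩ := h.exists_isNeighbour k
    rw [Set.encard_eq_one]
    refine ⟨z, Set.eq_singleton_iff_unique_mem.2 ⟨⟨hz.1, hz.2.1, (key z hz).1 hb⟩,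
      fun z' hz' => ?_⟩⟩
    exact h.isNeighbour_unique ⟨hz'.1, hz'.2.1, hz'.2.2.2.1⟩ hz
  · rw [Set.encard_eq_zero, Set.eq_empty_iff_forall_notMem]
    rintro z ⟨hz, hzx, hz'⟩
    exact hb ((key z ⟨hz, hzx, hz'.2.1⟩).2 hz')

end Neighbours

/-! ### Measurability of neighbour distances; integrals -/

section Measurability

variable {M : Type*} [MetricSpace M] [MeasurableSpace M] [BorelSpace M]
  [SecondCountableTopology M] {α : Type*} [MeasurableSpace α]

theorem measurable_ballCount {f : α → Config M} (hf : Measurable f) {x : α → M}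
    (hx : Measurable x) {r : α → ℝ} (hr : Measurable r) :
    Measurable fun a => ballCount (f a).carrier (x a) (r a) := by
  have ht : MeasurableSet {p : α × M | p.2 ≠ x p.1 ∧ dist p.2 (x p.1) ≤ r p.1} :=
    (measurableSet_eq_fun measurable_snd (hx.comp measurable_fst)).compl.inter
      (measurableSet_le (measurable_snd.dist (hx.comp measurable_fst)) (hr.comp measurable_fst))
  have h := Config.measurable_counting_section hf ht
  refine measurable_to_countable' fun n => ?_
  convert h (measurableSet_singleton (n : ℝ≥0∞)) using 1
  ext a
  have : Prod.mk a ⁻¹' {p : α × M | p.2 ≠ x p.1 ∧ dist p.2 (x p.1) ≤ r p.1} =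
      {x a}ᶜ ∩ Metric.closedBall (x a) (r a) := by
    ext y; simp
  simp only [Set.mem_preimage, Set.mem_singleton_iff]
  rw [this, Config.counting_apply _ ((measurableSet_singleton _).compl.inter
    Metric.isClosed_closedBall.measurableSet), ← Set.inter_assoc]
  simp [ballCount, Set.sdiff_eq]

theorem measurable_nnDist {f : α → Config M} (hf : Measurable f) {x : α → M}
    (hx : Measurable x) (l : ℕ) : Measurable fun a => nnDist (f a).carrier (x a) l := by
  refine measurable_of_Iio fun t => ?_
  have hq : ∀ q : ℚ, MeasurableSet {a | (l : ℕ∞) ≤ ballCount (f a).carrier (x a) q} := fun q =>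
    measurable_ballCount hf hx (measurable_const (a := (q : ℝ))) (.of_discrete (s := Set.Ici _))
  rcases le_or_gt t 0 with ht | ht
  · convert MeasurableSet.empty
    ext a
    simpa using ht.trans (nnDist_nonneg _ _ _)
  -- The infimum of the empty set is `0`, whence the second alternative.
  have : (fun a => nnDist (f a).carrier (x a) l) ⁻¹' Set.Iio t =
      (⋃ q : {q : ℚ // 0 ≤ q ∧ (q : ℝ) < t},
        {a | (l : ℕ∞) ≤ ballCount (f a).carrier (x a) (q : ℚ)}) ∪
      (⋃ q : {q : ℚ // 0 ≤ q}, {a | (l : ℕ∞) ≤ ballCount (f a).carrier (x a) (q : ℚ)})ᶜ := by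
    ext a
    set A := {r : ℝ | 0 ≤ r ∧ (l : ℕ∞) ≤ ballCount (f a).carrier (x a) r} with hA
    have hbdd : BddBelow A := ⟨0, fun r hr => hr.1⟩
    change sInf A < t ↔ _
    simp only [Set.mem_union, Set.mem_iUnion, Set.mem_compl_iff, Set.mem_ofPred_eq, Subtype.exists,
      exists_prop]
    constructor
    · intro h
      by_contra! hcon
      obtain ⟨h1, q, hq0, hq⟩ := hcon
      obtain ⟨r, hr, hrt⟩ := (csInf_lt_iff hbdd ⟨q, by exact_mod_cast hq0, hq⟩).1 h
      obtain ⟨q', hq', hqt⟩ := exists_rat_btwn hrt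
      exact absurd (hr.2.trans (ballCount_mono _ _ hq'.le))
        (h1 q' ⟨by exact_mod_cast hr.1.trans hq'.le, hqt⟩).not_ge
    · rintro (⟨q, ⟨hq0, hqt⟩, hq⟩ | h)
      · exact (csInf_le hbdd ⟨by exact_mod_cast hq0, hq⟩).trans_lt hqt
      · have : A = ∅ := by
          rw [Set.eq_empty_iff_forall_notMem]
          rintro r ⟨hr0, hr⟩
          obtain ⟨q, hq⟩ := exists_rat_gt r
          exact h ⟨q, by exact_mod_cast hr0.trans hq.le, hr.trans (ballCount_mono _ _ hq.le)⟩
        rw [this, Real.sInf_empty]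
        exact ht
  rw [this]
  exact (MeasurableSet.iUnion fun q => hq _).union (MeasurableSet.iUnion fun q => hq _).compl

theorem measurable_nnRatio {f : α → Config M} (hf : Measurable f) {x : α → M}
    (hx : Measurable x) (l : ℕ) : Measurable fun a => nnRatio (f a).carrier (x a) l :=
  (measurable_nnDist hf hx l).div (measurable_nnDist hf hx (l - 1))

theorem measurableSet_ratiosGe {f : α → Config M} (hf : Measurable f) {x : α → M}
    (hx : Measurable x) (y : ℕ → ℝ) (n : ℕ) :
    MeasurableSet {a | RatiosGe y (f a).carrier (x a) n} := by
  simp only [RatiosGe, Set.ofPred_forall]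
  exact .iInter fun j => .iInter fun _ => measurableSet_le
    ((measurable_nnDist hf hx j).const_mul _) (measurable_nnDist hf hx _)

theorem measurableSet_ballRatiosGe {f : α → Config M} (hf : Measurable f) (x : M) (y : ℕ → ℝ)
    (k : ℕ) {r R : α → ℝ} (hr : Measurable r) (hR : Measurable R) :
    MeasurableSet {a | BallRatiosGe y x k (f a).carrier (r a) (R a)} :=
  (measurable_ballCount hf measurable_const hr (measurableSet_singleton _)).inter <|
    (measurable_ballCount hf measurable_const hR (measurableSet_singleton _)).inter <|
    (measurableSet_ratiosGe hf measurable_const y k).inter <|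
    measurableSet_le ((measurable_nnDist hf measurable_const k).const_mul _) hr

end Measurability

section BallVolume

variable {M : Type*} [MetricSpace M] [MeasurableSpace M] [BorelSpace M]
  {Λ : Measure M} {d : ℕ} {c : ℝ}

omit [BorelSpace M] in
theorem HasBallVolume.sigmaFinite (hΛ : HasBallVolume Λ d c) : SigmaFinite Λ := by
  rcases isEmpty_or_nonempty M with h | ⟨⟨x⟩⟩
  · have : Λ = 0 := Measure.eq_zero_of_isEmpty Λ
    rw [this]; infer_instance
  · refine ⟨⟨⟨fun n : ℕ => Metric.closedBall x n, fun _ => trivial, fun n => ?_,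
      Metric.iUnion_closedBall_nat x⟩⟩⟩
    rw [hΛ x n (Nat.cast_nonneg n)]
    exact ENNReal.ofReal_lt_top

/-- In terms of the volume of the ball through a point, the intensity is Lebesgue measure. -/
theorem HasBallVolume.map_eq (hΛ : HasBallVolume Λ d c) (hd : d ≠ 0) (hc : 0 < c) (x : M) :
    Λ.map (fun z => c * dist z x ^ d) = volume.restrict (Set.Ici 0) := by
  have hm : Measurable fun z : M => c * dist z x ^ d := by fun_prop
  have h1 : ∀ b, Λ.map (fun z => c * dist z x ^ d) (Set.Iic b) = ENNReal.ofReal b := by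
    intro b
    rw [Measure.map_apply hm measurableSet_Iic]
    rcases lt_or_ge b 0 with hb | hb
    · rw [ENNReal.ofReal_of_nonpos hb.le]
      convert measure_empty (μ := Λ)
      ext z
      simpa using hb.trans_le (by positivity)
    · have hr : 0 ≤ (b / c) ^ ((d : ℝ)⁻¹) := by positivity
      have hpow : ((b / c) ^ ((d : ℝ)⁻¹)) ^ d = b / c :=
        Real.rpow_inv_natCast_pow (by positivity) hd
      have : (fun z => c * dist z x ^ d) ⁻¹' Set.Iic b =
          Metric.closedBall x ((b / c) ^ ((d : ℝ)⁻¹)) := by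
        ext z
        rw [Metric.mem_closedBall, ← pow_le_pow_iff_left₀ dist_nonneg hr hd, hpow,
          le_div_iff₀' hc]
        rfl
      rw [this, hΛ x _ hr, hpow, mul_div_cancel₀ _ hc.ne']
  have h2 : ∀ b : ℝ, volume.restrict (Set.Ici 0) (Set.Iic b) = ENNReal.ofReal b := by
    intro b
    rw [Measure.restrict_apply measurableSet_Iic, Set.inter_comm, Set.Ici_inter_Iic,
      Real.volume_Icc, sub_zero]
  have h3 : ∀ (μ : Measure ℝ), (∀ b, μ (Set.Iic b) = ENNReal.ofReal b) → ∀ {a b : ℝ}, a < b →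
      μ (Set.Ioc a b) = ENNReal.ofReal b - ENNReal.ofReal a := by
    intro μ hμ a b hab
    rw [← hμ, ← hμ, ← measure_sdiff (Set.Iic_subset_Iic.2 hab.le)
      measurableSet_Iic.nullMeasurableSet (by rw [hμ]; exact ENNReal.ofReal_ne_top)]
    congr 1
    ext t
    simp [and_comm]
  refine Measure.ext_of_Ioc' _ _ (fun a b hab => ?_) fun a b hab => ?_
  · rw [h3 _ h1 hab]
    exact (tsub_le_self.trans_lt ENNReal.ofReal_lt_top).ne
  · rw [h3 _ h1 hab, h3 _ h2 hab]

theorem HasBallVolume.measure_sphere (hΛ : HasBallVolume Λ d c) (hd : d ≠ 0) (hc : 0 < c) (x : M)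
    (r : ℝ) : Λ {z | dist z x = r} = 0 := by
  have h : Λ ((fun z => c * dist z x ^ d) ⁻¹' {c * r ^ d}) = 0 := by
    rw [← Measure.map_apply (by fun_prop) (measurableSet_singleton _), hΛ.map_eq hd hc]
    exact measure_mono_null le_rfl (Measure.absolutelyContinuous_of_le Measure.restrict_le_self
      (measure_singleton _))
  exact measure_mono_null (fun z hz => by simp_all) h

omit [BorelSpace M] in
theorem HasBallVolume.measure_singleton (hΛ : HasBallVolume Λ d c) (hd : d ≠ 0) (x : M) :
    Λ {x} = 0 := by
  rw [← Metric.closedBall_zero, hΛ x 0 le_rfl]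
  simp [hd]

theorem HasBallVolume.measure_univ (hΛ : HasBallVolume Λ d c) (hd : d ≠ 0) (hc : 0 < c) (x : M) :
    Λ Set.univ = ∞ := by
  have h := congrArg (fun μ => μ Set.univ) (hΛ.map_eq hd hc x)
  rw [Measure.map_apply (by fun_prop) .univ, Measure.restrict_apply_univ, Real.volume_Ici] at h
  exact h

end BallVolume

section Integrals

theorem lintegral_pow_div_factorial {K b : ℝ} (hK : 0 ≤ K) (hb : 0 ≤ b) (k : ℕ) :
    ∫⁻ v in Set.Ici 0, (Set.Iic b).indicator
      (fun v => ENNReal.ofReal (K * (v ^ k / k.factorial))) v =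
      ENNReal.ofReal (K * (b ^ (k + 1) / (k + 1).factorial)) := by
  rw [setLIntegral_indicator measurableSet_Iic, Set.inter_comm, Set.Ici_inter_Iic,
    ← ofReal_integral_eq_lintegral_ofReal]
  · congr 1
    rw [integral_Icc_eq_integral_Ioc, ← intervalIntegral.integral_of_le hb,
      intervalIntegral.integral_const_mul, intervalIntegral.integral_div, integral_pow,
      Nat.factorial_succ]
    push_cast
    rw [zero_pow k.succ_ne_zero, sub_zero]
    field_simp
  · exact (Continuous.integrableOn_Icc (by fun_prop))
  · filter_upwards [ae_restrict_mem measurableSet_Icc] with v hv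
    have := hv.1
    positivity

theorem lintegral_exp_neg_mul_pow_div_factorial {K : ℝ} (hK : 0 ≤ K) (k : ℕ) :
    ∫⁻ v in Set.Ici 0, ENNReal.ofReal (Real.exp (-v) * v ^ k / k.factorial * K) =
      ENNReal.ofReal K := by
  have h := lintegral_gammaPDF_eq_one (a := k + 1) (r := 1) (by positivity) one_pos
  have h2 : ∀ v, gammaPDF (k + 1) 1 v = (Set.Ici (0 : ℝ)).indicator
      (fun v => ENNReal.ofReal (Real.exp (-v) * v ^ k / k.factorial)) v := by
    intro v
    rw [gammaPDF, gammaPDFReal, Real.Gamma_nat_eq_factorial]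
    by_cases hv : 0 ≤ v
    · rw [if_pos hv, Set.indicator_of_mem (by exact hv)]
      congr 1
      simp
      ring
    · rw [if_neg hv, Set.indicator_of_notMem (by exact hv), ENNReal.ofReal_zero]
  simp_rw [h2] at h
  rw [lintegral_indicator measurableSet_Ici] at h
  simp_rw [ENNReal.ofReal_mul' hK]
  rw [lintegral_mul_const' _ _ ENNReal.ofReal_ne_top, h, one_mul]

theorem paretoMeasure_Ici {a : ℝ} (ha : 0 < a) (t : ℝ) :
    paretoMeasure 1 a (Set.Ici t) = ENNReal.ofReal ((max 1 t) ^ (-a)) := by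
  have h : paretoPDF 1 a = (Set.Ici (1 : ℝ)).indicator
      (fun v => ENNReal.ofReal (a * v ^ (-(a + 1)))) := by
    ext v
    by_cases hv : 1 ≤ v
    · rw [paretoPDF_of_le hv, Set.indicator_of_mem (by exact hv), Real.one_rpow, mul_one]
    · rw [paretoPDF_of_lt (not_le.1 hv), Set.indicator_of_notMem (by exact hv)]
  have ht : 0 < max 1 t := lt_max_of_lt_left one_pos
  rw [paretoMeasure, withDensity_apply _ measurableSet_Ici, h,
    setLIntegral_indicator measurableSet_Ici, Set.Ici_inter_Ici,
    ← ofReal_integral_eq_lintegral_ofReal]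
  · rw [integral_Ici_eq_integral_Ioi, integral_const_mul, integral_Ioi_rpow_of_lt (by linarith) ht]
    congr 1
    rw [neg_add, neg_add_cancel_right]
    field_simp
  · rw [← IntegrableOn, integrableOn_Ici_iff_integrableOn_Ioi]
    exact (integrableOn_Ioi_rpow_of_lt (by linarith) ht).const_mul a
  · filter_upwards [ae_restrict_mem measurableSet_Ici] with v hv
    have : 0 < v := ht.trans_le hv
    simp only [Pi.zero_apply]
    positivity

end Integrals

/-! ### The joint law of the ratios at a fixed location -/

section RatioLaw

variable {M : Type*} [MetricSpace M] [MeasurableSpace M] [BorelSpace M]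
  [SecondCountableTopology M] {Ω : Type*} [MeasurableSpace Ω] {P : Measure Ω}
  [IsProbabilityMeasure P] {Λ : Measure M} {d : ℕ} {c : ℝ} {Ψ : Ω → Config M}

theorem Config.counting_setOf (S : Config M) (p : M → Prop) :
    S.counting {z | p z} = ({z ∈ S.carrier | p z}.encard : ℝ≥0∞) := by
  rw [Config.counting, Measure.restrict_apply' S.measurableSet, Set.inter_comm,
    Measure.count_apply ]
  · rfl
  · exact (S.countable.mono Set.inter_subset_left).measurableSet

/-- Almost surely, the configuration is infinite and its points have distinct distances to `x`. -/
theorem IsPoissonProcess.ae_isGeneric (hΨ : Measurable Ψ)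
    (h : IsPoissonProcess (fun w => (Ψ w).carrier) Λ P) (hΛ : HasBallVolume Λ d c) (hd : d ≠ 0)
    (hc : 0 < c) (x : M) : ∀ᵐ w ∂P, IsGeneric (Ψ w).carrier x := by
  have := hΛ.sigmaFinite
  have hinf := h.count_eq_top Set.univ .univ (hΛ.measure_univ hd hc x)
  -- By Mecke's equation, the mean number of points at the same distance from `x` as another point
  -- is an integral of measures of spheres.
  set u : Set ((M × Config M) × M) := {q | dist q.2 x = dist q.1.1 x}
  have hu : MeasurableSet u := measurableSet_eq_fun (by fun_prop) (by fun_prop)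
  set t : Set (M × Config M) := {q | q.2.counting {y | dist y x = dist q.1 x} ≠ 0}
  have ht : MeasurableSet t :=
    (Config.measurable_counting_section measurable_snd hu) (measurableSet_singleton 0).compl
  have hnull : ∀ z, P {w | (z, Ψ w) ∈ t} = 0 := by
    intro z
    have hB : MeasurableSet {y | dist y x = dist z x} :=
      measurableSet_eq_fun (by fun_prop) measurable_const
    exact (lintegral_eq_zero_iff (f := fun w => (Ψ w).counting {y | dist y x = dist z x})
      ((Config.measurable_counting hB).comp hΨ)).1
      ((h.lintegral_counting hΨ hB).trans (hΛ.measure_sphere hd hc x _))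
  have h1 := h.mecke hΨ ht
  simp only [hnull, lintegral_zero] at h1
  rw [lintegral_eq_zero_iff] at h1
  · filter_upwards [h1, hinf] with w hw hinf
    refine ⟨(Ψ w).finite_inter x, ?_, fun z hz z' hz' hzz => ?_⟩
    · rwa [Set.inter_univ, Set.encard_eq_top_iff] at hinf
    · by_contra hne
      change (Ψ w).counting {z | (z, (Ψ w).erase z) ∈ t} = 0 at hw
      rw [Config.counting_setOf] at hw
      have hw' : {z ∈ (Ψ w).carrier | (z, (Ψ w).erase z) ∈ t} = ∅ := by simpa using hw
      refine (Set.eq_empty_iff_forall_notMem.1 hw') z ⟨hz, ?_⟩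
      change ((Ψ w).erase z).counting {y | dist y x = dist z x} ≠ 0
      rw [Config.counting_setOf]
      have : {y ∈ ((Ψ w).erase z).carrier | dist y x = dist z x}.Nonempty :=
        ⟨z', ⟨hz', fun e => hne e.symm⟩, hzz.symm⟩
      simpa using this.ne_empty
  · exact Config.measurable_counting_section hΨ (t := {q | (q.2, (Ψ q.1).erase q.2) ∈ t})
      (measurable_erase_pair hΨ ht)

omit [IsProbabilityMeasure P] in
theorem IsPoissonProcess.measure_ballCount_eq_zero
    (h : IsPoissonProcess (fun w => (Ψ w).carrier) Λ P) (hΛ : HasBallVolume Λ d c) (hd : d ≠ 0)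
    (hc : 0 < c) (x : M) {R : ℝ} (hR : 0 ≤ R) :
    P {w | ballCount (Ψ w).carrier x R = 0} = ENNReal.ofReal (Real.exp (-(c * R ^ d))) := by
  have hB : MeasurableSet ({x}ᶜ ∩ Metric.closedBall x R) :=
    (measurableSet_singleton x).compl.inter Metric.isClosed_closedBall.measurableSet
  have hΛB : Λ ({x}ᶜ ∩ Metric.closedBall x R) = ENNReal.ofReal (c * R ^ d) := by
    rw [← hΛ x R hR, Set.inter_comm, ← Set.sdiff_eq]
    exact measure_sdiff_null (hΛ.measure_singleton hd x)
  have hlaw := h.law_count _ hB (by rw [hΛB]; exact ENNReal.ofReal_ne_top)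
  have h1 := congrArg (fun μ => μ {0}) hlaw
  rw [Measure.map_apply (h.measurable_count _ hB) (measurableSet_singleton _),
    Measure.map_apply .of_discrete (measurableSet_singleton _)] at h1
  have h2 : (fun n : ℕ => (n : ℕ∞)) ⁻¹' {0} = {0} := by ext n; simp
  rw [h2, poissonMeasure_singleton, hΛB] at h1
  have hnn : 0 ≤ c * R ^ d := by positivity
  have h3 : {w | ballCount (Ψ w).carrier x R = 0} =
      (fun w => ((Ψ w).carrier ∩ ({x}ᶜ ∩ Metric.closedBall x R)).encard) ⁻¹' {0} := by
    ext w
    rw [Set.mem_preimage, ← Set.inter_assoc]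
    rfl
  rw [h3, h1]
  congr 1
  change Real.exp (-((ENNReal.ofReal (c * R ^ d)).toReal)) * _ / _ = _
  rw [ENNReal.toReal_ofReal hnn]
  simp

/-- The probability of the condition on the ratios in a ball, by induction on `k`: Mecke's equation
is applied to the sum over the farthest neighbour `z`, and the induction hypothesis to the ball
through `z`. -/
theorem IsPoissonProcess.measure_ballRatiosGe (hΨ : Measurable Ψ)
    (h : IsPoissonProcess (fun w => (Ψ w).carrier) Λ P) (hΛ : HasBallVolume Λ d c) (hd : d ≠ 0)
    (hc : 0 < c) (x : M) {y : ℕ → ℝ} (hy : ∀ j, 1 ≤ y j) (k : ℕ) {r R : ℝ} (hr : 0 ≤ r)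
    (hrR : r ≤ R) :
    P {w | BallRatiosGe y x k (Ψ w).carrier r R} =
      ENNReal.ofReal (Real.exp (-(c * R ^ d)) * ((c * r ^ d) ^ k / k.factorial) *
        ∏ j ∈ Finset.range (k + 1), ((y j) ^ (j * d))⁻¹) := by
  classical
  have := hΛ.sigmaFinite
  induction k generalizing r R with
  | zero =>
    have : ∀ w, BallRatiosGe y x 0 (Ψ w).carrier r R ↔ ballCount (Ψ w).carrier x R = 0 := by
      intro w
      refine ⟨fun hw => hw.2.1, fun hw => ⟨?_, hw, fun j hj => absurd hj j.not_lt_zero, ?_⟩⟩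
      · exact nonpos_iff_eq_zero.1 ((ballCount_mono _ _ hrR).trans hw.le)
      · rw [nnDist_zero, mul_zero]; exact hr
    simp_rw [this]
    rw [h.measure_ballCount_eq_zero hΛ hd hc x (hr.trans hrR)]
    simp
  | succ k ih =>
    have hypos : ∀ j, 0 < y j := fun j => one_pos.trans_le (hy j)
    set t : Set (M × Config M) := {q | q.1 ≠ x ∧ y (k + 1) * dist q.1 x ≤ r ∧
      BallRatiosGe y x k q.2.carrier (dist q.1 x) R}
    have ht : MeasurableSet t := by
      refine (measurableSet_eq_fun measurable_fst measurable_const).compl.inter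
        ((measurableSet_le (f := fun q : M × Config M => y (k + 1) * dist q.1 x)
          (by fun_prop) (measurable_const (a := r))).inter
        (measurableSet_ballRatiosGe measurable_snd x y k
          (r := fun q => dist q.1 x) (by fun_prop) (measurable_const (a := R))))
    have hmeas := measurableSet_ballRatiosGe hΨ x y (k + 1) (measurable_const (a := r))
      (measurable_const (a := R))
    have h1 := h.mecke hΨ ht
    have h2 : ∫⁻ w, (Ψ w).counting {z | (z, (Ψ w).erase z) ∈ t} ∂P =
        P {w | BallRatiosGe y x (k + 1) (Ψ w).carrier r R} := by
      rw [← lintegral_indicator_one hmeas]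
      refine lintegral_congr_ae ?_
      filter_upwards [h.ae_isGeneric hΨ hΛ hd hc x] with w hw
      rw [Config.counting_setOf]
      have := hw.encard_ballRatiosGe (k := k) (hy _) hrR
      refine (congrArg (fun n : ℕ∞ => (n : ℝ≥0∞)) this).trans ?_
      rw [Set.indicator_apply]
      simp only [Set.mem_ofPred_eq]
      split_ifs <;> simp
    set C := ∏ j ∈ Finset.range (k + 1), ((y j) ^ (j * d))⁻¹
    have hC : 0 ≤ C := Finset.prod_nonneg fun j _ => by have := hypos j; positivity
    set b := c * (r / y (k + 1)) ^ d
    have hb : 0 ≤ b := by have := hypos (k + 1); positivity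
    set K := Real.exp (-(c * R ^ d)) * C
    have hK : 0 ≤ K := by positivity
    set g : ℝ → ℝ≥0∞ := (Set.Iic b).indicator
      (fun v => ENNReal.ofReal (K * (v ^ k / k.factorial))) with hg
    have hgm : Measurable g := Measurable.indicator (by fun_prop) measurableSet_Iic
    have h3 : ∫⁻ z, P {w | (z, Ψ w) ∈ t} ∂Λ = ∫⁻ z, g (c * dist z x ^ d) ∂Λ := by
      refine lintegral_congr_ae ?_
      have hx : ∀ᵐ z ∂Λ, z ≠ x := measure_eq_zero_iff_ae_notMem.1 (hΛ.measure_singleton hd x)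
      filter_upwards [hx] with z hz
      have hiff : y (k + 1) * dist z x ≤ r ↔ c * dist z x ^ d ∈ Set.Iic b := by
        rw [Set.mem_Iic, mul_le_mul_iff_right₀ hc, pow_le_pow_iff_left₀ dist_nonneg
          (div_nonneg hr (hypos _).le) hd, le_div_iff₀' (hypos _)]
      by_cases hzr : y (k + 1) * dist z x ≤ r
      · rw [hg, Set.indicator_of_mem (hiff.1 hzr)]
        have hzr' : dist z x ≤ r := (le_mul_of_one_le_left dist_nonneg (hy _)).trans hzr
        have : {w | (z, Ψ w) ∈ t} = {w | BallRatiosGe y x k (Ψ w).carrier (dist z x) R} := by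
          ext w
          exact ⟨fun hw => hw.2.2, fun hw => ⟨hz, hzr, hw⟩⟩
        rw [this, ih dist_nonneg (hzr'.trans hrR)]
        congr 1
        ring
      · rw [hg, Set.indicator_of_notMem fun hm => hzr (hiff.2 hm)]
        refine measure_mono_null (t := ∅) (fun w hw => hzr hw.2.1) measure_empty
    rw [← h2, h1, h3, ← lintegral_map (f := g) hgm (by fun_prop), hΛ.map_eq hd hc,
      lintegral_pow_div_factorial hK hb]
    congr 1
    rw [Finset.prod_range_succ _ (k + 1)]
    have := hypos (k + 1)
    have e : (y (k + 1)) ^ ((k + 1) * d) = ((y (k + 1)) ^ d) ^ (k + 1) := by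
      rw [← pow_mul, mul_comm]
    change Real.exp (-(c * R ^ d)) * C * ((c * (r / y (k + 1)) ^ d) ^ (k + 1) / _) = _ * (C * _)
    rw [e, div_pow, ← mul_div_assoc c, div_pow]
    ring

/-- The joint tail of the ratios for constants `y j ≥ 1`, from Mecke's equation for the neighbour of
order `k + 1`. The factor with `j = 0` is `1`, as the condition is void for `j = 0`. -/
theorem IsPoissonProcess.measure_ratiosGe (hΨ : Measurable Ψ)
    (h : IsPoissonProcess (fun w => (Ψ w).carrier) Λ P) (hΛ : HasBallVolume Λ d c) (hd : d ≠ 0)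
    (hc : 0 < c) (x : M) {y : ℕ → ℝ} (hy : ∀ j, 1 ≤ y j) (k : ℕ) :
    P {w | RatiosGe y (Ψ w).carrier x (k + 1)} =
      ENNReal.ofReal (∏ j ∈ Finset.range (k + 1), ((y j) ^ (j * d))⁻¹) := by
  classical
  have := hΛ.sigmaFinite
  have hypos : ∀ j, 0 < y j := fun j => one_pos.trans_le (hy j)
  set t : Set (M × Config M) := {q | q.1 ≠ x ∧
    BallRatiosGe y x k q.2.carrier (dist q.1 x) (dist q.1 x)}
  have ht : MeasurableSet t :=
    (measurableSet_eq_fun measurable_fst measurable_const).compl.inter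
      (measurableSet_ballRatiosGe measurable_snd x y k (r := fun q => dist q.1 x)
        (R := fun q => dist q.1 x) (by fun_prop) (by fun_prop))
  have hmeas := measurableSet_ratiosGe hΨ (measurable_const (a := x)) y (k + 1)
  have h1 := h.mecke hΨ ht
  have h2 : ∫⁻ w, (Ψ w).counting {z | (z, (Ψ w).erase z) ∈ t} ∂P =
      P {w | RatiosGe y (Ψ w).carrier x (k + 1)} := by
    rw [← lintegral_indicator_one hmeas]
    refine lintegral_congr_ae ?_
    filter_upwards [h.ae_isGeneric hΨ hΛ hd hc x] with w hw
    rw [Config.counting_setOf]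
    refine (congrArg (fun n : ℕ∞ => (n : ℝ≥0∞)) (hw.encard_ratiosGe y k)).trans ?_
    rw [Set.indicator_apply]
    simp only [Set.mem_ofPred_eq]
    split_ifs <;> simp
  set C := ∏ j ∈ Finset.range (k + 1), ((y j) ^ (j * d))⁻¹
  have hC : 0 ≤ C := Finset.prod_nonneg fun j _ => by have := hypos j; positivity
  have h3 : ∫⁻ z, P {w | (z, Ψ w) ∈ t} ∂Λ = ∫⁻ z, (fun v => ENNReal.ofReal
      (Real.exp (-v) * v ^ k / k.factorial * C)) (c * dist z x ^ d) ∂Λ := by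
    refine lintegral_congr_ae ?_
    have hx : ∀ᵐ z ∂Λ, z ≠ x := measure_eq_zero_iff_ae_notMem.1 (hΛ.measure_singleton hd x)
    filter_upwards [hx] with z hz
    have : {w | (z, Ψ w) ∈ t} =
        {w | BallRatiosGe y x k (Ψ w).carrier (dist z x) (dist z x)} := by
      ext w
      exact ⟨fun hw => hw.2, fun hw => ⟨hz, hw⟩⟩
    rw [this, h.measure_ballRatiosGe hΨ hΛ hd hc x hy k dist_nonneg le_rfl, mul_div_assoc]
  rw [← h2, h1, h3, ← lintegral_map (f := fun v => ENNReal.ofReal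
    (Real.exp (-v) * v ^ k / k.factorial * C)) (by fun_prop) (by fun_prop), hΛ.map_eq hd hc,
    lintegral_exp_neg_mul_pow_div_factorial hC]

/-- The joint tail of the ratios, for arbitrary constants: almost surely the ratios are at least
`1`, so that `u l` may be replaced by `max 1 (u l)`, and a missing condition by `1`. -/
theorem IsPoissonProcess.measure_forall_le_nnRatio (hΨ : Measurable Ψ)
    (h : IsPoissonProcess (fun w => (Ψ w).carrier) Λ P) (hΛ : HasBallVolume Λ d c) (hd : d ≠ 0)
    (hc : 0 < c) (x : M) (s : Finset ℕ) (hs : ∀ l ∈ s, 2 ≤ l) (u : ℕ → ℝ) :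
    P {w | ∀ l ∈ s, nnRatio (Ψ w).carrier x l ∈ Set.Ici (u l)} =
      ∏ l ∈ s, paretoMeasure 1 (((l : ℝ) - 1) * d) (Set.Ici (u l)) := by
  classical
  obtain ⟨k, hk⟩ : ∃ k, ∀ l ∈ s, l - 1 < k + 1 := by
    refine ⟨s.sup id, fun l hl => ?_⟩
    have : id l ≤ s.sup id := Finset.le_sup hl
    simp only [id] at this
    omega
  set y : ℕ → ℝ := fun j => if j + 1 ∈ s then max 1 (u (j + 1)) else 1
  have hy : ∀ j, 1 ≤ y j := by
    intro j
    simp only [y]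
    split_ifs
    exacts [le_max_left _ _, le_rfl]
  have h1 : P {w | ∀ l ∈ s, nnRatio (Ψ w).carrier x l ∈ Set.Ici (u l)} =
      P {w | RatiosGe y (Ψ w).carrier x (k + 1)} := by
    refine measure_congr ?_
    filter_upwards [h.ae_isGeneric hΨ hΛ hd hc x] with w hw
    refine propext ?_
    change (∀ l ∈ s, u l ≤ nnRatio (Ψ w).carrier x l) ↔ ∀ j < k + 1, _
    constructor
    · intro hl j _
      by_cases hj : j + 1 ∈ s
      · have h2 := hs _ hj
        have hpos : 0 < nnDist (Ψ w).carrier x j := by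
          obtain ⟨i, rfl⟩ : ∃ i, j = i + 1 := ⟨j - 1, by omega⟩
          exact hw.nnDist_pos i
        have h3 := hl _ hj
        rw [nnRatio, Nat.add_sub_cancel, le_div_iff₀ hpos] at h3
        simp only [y, if_pos hj]
        rw [max_mul_of_nonneg _ _ hpos.le, one_mul]
        exact max_le (hw.nnDist_le_succ j) h3
      · simp only [y, if_neg hj, one_mul]
        exact hw.nnDist_le_succ j
    · intro hj l hl
      obtain ⟨i, rfl⟩ : ∃ i, l = i + 2 := ⟨l - 2, by have := hs l hl; omega⟩
      have h3 := hj (i + 1) (hk _ hl)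
      have hpos := hw.nnDist_pos i
      simp only [y, if_pos hl] at h3
      rw [nnRatio, show i + 2 - 1 = i + 1 from rfl, le_div_iff₀ hpos]
      exact (mul_le_mul_of_nonneg_right (le_max_right _ _) hpos.le).trans h3
  rw [h1, h.measure_ratiosGe hΨ hΛ hd hc x hy k, ENNReal.ofReal_prod_of_nonneg]
  · set F : ℕ → ℝ≥0∞ := fun l => ENNReal.ofReal ((max 1 (u l)) ^ ((l - 1) * d))⁻¹
    have hF : ∀ j, ENNReal.ofReal ((y j) ^ (j * d))⁻¹ = if j + 1 ∈ s then F (j + 1) else 1 := by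
      intro j
      simp only [y, F]
      split_ifs <;> simp
    have hP : ∀ l ∈ s, paretoMeasure 1 (((l : ℝ) - 1) * d) (Set.Ici (u l)) = F l := by
      intro l hl
      have hl2 : 2 ≤ l := hs l hl
      have hl1 : (1 : ℝ) < l := by exact_mod_cast hl2
      have hd0 : (0 : ℝ) < d := by exact_mod_cast Nat.pos_of_ne_zero hd
      rw [paretoMeasure_Ici (mul_pos (by linarith) hd0),
        Real.rpow_neg (zero_le_one.trans (le_max_left _ _))]
      simp only [F]
      rw [← Real.rpow_natCast]
      push_cast [Nat.cast_sub (one_le_two.trans hl2)]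
      rfl
    rw [Finset.prod_congr rfl hP, Finset.prod_congr rfl fun j _ => hF j, ← Finset.prod_filter]
    refine Finset.prod_nbij (· + 1) (by simp) (by simp) (fun l hl => ?_) fun _ _ => rfl
    have hl2 := hs l hl
    have hlk := hk l hl
    have he : l - 1 + 1 = l := by omega
    exact ⟨l - 1, by simpa [he] using ⟨by omega, hl⟩, he⟩
  · intro j _
    have := one_pos.trans_le (hy j)
    positivity

end RatioLaw

/-! ### Poisson processes as random configurations; typical points -/

section Main

variable {M : Type*} [MetricSpace M] [MeasurableSpace M] [BorelSpace M]
  {Ω : Type*} [MeasurableSpace Ω] {P : Measure Ω}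
  {Λ : Measure M} {d : ℕ} {c : ℝ} {Φ : Ω → Set M} {Ψ : Ω → Config M}

/-- Almost surely, a Poisson process with finite intensity on balls has finitely many points in
every ball, so that it is a random element of `Config M`. -/
theorem IsPoissonProcess.exists_config (h : IsPoissonProcess Φ Λ P) (hΛ : HasBallVolume Λ d c)
    (x : M) : ∃ Ψ : Ω → Config M, Measurable Ψ ∧ ∀ᵐ w ∂P, (Ψ w).carrier = Φ w := by
  classical
  set G : Set Ω := {w | ∀ n : ℕ, (Φ w ∩ Metric.closedBall x n).encard ≠ ⊤}
  have hball : ∀ n : ℕ, MeasurableSet (Metric.closedBall x n) :=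
    fun n => Metric.isClosed_closedBall.measurableSet
  have hG : MeasurableSet G := by
    simp only [G, Set.ofPred_forall]
    exact .iInter fun n => h.measurable_count _ (hball n) (.of_discrete (s := {⊤}ᶜ))
  have hfin : ∀ w ∈ G, ∀ z r, (Φ w ∩ Metric.closedBall z r).Finite := by
    intro w hw z r
    obtain ⟨n, hn⟩ := exists_nat_ge (r + dist z x)
    refine (Set.encard_ne_top_iff.1 (hw n)).subset (Set.inter_subset_inter_right _ ?_)
    exact Metric.closedBall_subset_closedBall' hn
  refine ⟨fun w => if hw : w ∈ G then ⟨Φ w, hfin w hw⟩ else ⟨∅, by simp⟩, ?_, ?_⟩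
  · refine Config.measurable_of_counting fun B hB => ?_
    have : ∀ w, (if hw : w ∈ G then (⟨Φ w, hfin w hw⟩ : Config M) else ⟨∅, by simp⟩).counting B =
        if w ∈ G then ((Φ w ∩ B).encard : ℝ≥0∞) else 0 := by
      intro w
      split_ifs with hw <;> simp [Config.counting_apply _ hB]
    simp_rw [this]
    exact Measurable.ite hG ((Measurable.of_discrete (f := fun n : ℕ∞ => (n : ℝ≥0∞))).comp
      (h.measurable_count B hB)) measurable_const
  · have hae : ∀ n : ℕ, ∀ᵐ w ∂P, (Φ w ∩ Metric.closedBall x n).encard ≠ ⊤ := by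
      intro n
      have hlaw := congrArg (fun μ => μ {⊤}) (h.law_count _ (hball n) (by
        rw [hΛ x n (Nat.cast_nonneg n)]; exact ENNReal.ofReal_ne_top))
      rw [Measure.map_apply (h.measurable_count _ (hball n)) (measurableSet_singleton _),
        Measure.map_apply .of_discrete (measurableSet_singleton _)] at hlaw
      have h0 : (fun n : ℕ => (n : ℕ∞)) ⁻¹' {⊤} = ∅ := by ext n; simp
      rw [h0, measure_empty] at hlaw
      exact measure_eq_zero_iff_ae_notMem.1 hlaw
    filter_upwards [ae_all_iff.2 hae] with w hw
    rw [dif_pos (show w ∈ G from hw)]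

theorem IsPoissonProcess.congr (h : IsPoissonProcess Φ Λ P) (hΨ : Measurable Ψ)
    (hae : ∀ᵐ w ∂P, (Ψ w).carrier = Φ w) : IsPoissonProcess (fun w => (Ψ w).carrier) Λ P := by
  have hB : ∀ B : Set M,
      (fun w => (Φ w ∩ B).encard) =ᵐ[P] fun w => ((Ψ w).carrier ∩ B).encard := by
    intro B
    filter_upwards [hae] with w hw
    rw [hw]
  refine ⟨fun w => (Ψ w).countable, fun B hB => (Config.measurable_encard hB).comp hΨ,
    fun B hBm hΛ => (Measure.map_congr (hB B)).symm.trans (h.law_count B hBm hΛ),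
    fun B hBm hΛ => ?_, fun n B hBm hdisj => (h.indep_count n B hBm hdisj).congr fun i => hB _⟩
  filter_upwards [hB B, h.count_eq_top B hBm hΛ] with w hw hw'
  exact hw.symm.trans hw'

omit [MeasurableSpace M] [BorelSpace M] in
theorem nnRatio_sdiff_self (S : Set M) (x : M) (l : ℕ) :
    nnRatio (S \ {x}) x l = nnRatio S x l := by
  simp only [nnRatio, nnDist, sdiff_idem]

variable [SecondCountableTopology M] [IsProbabilityMeasure P]

theorem IsPoissonProcess.hasLaw_nnRatio (hΨ : Measurable Ψ)
    (h : IsPoissonProcess (fun w => (Ψ w).carrier) Λ P) (hΛ : HasBallVolume Λ d c) (hd : d ≠ 0)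
    (hc : 0 < c) (x : M) {l : ℕ} (hl : 2 ≤ l) :
    HasLaw (fun w => nnRatio (Ψ w).carrier x l) (paretoMeasure 1 (((l : ℝ) - 1) * d)) P := by
  have hm := measurable_nnRatio hΨ (measurable_const (a := x)) l
  refine ⟨hm.aemeasurable, ?_⟩
  have : IsProbabilityMeasure (P.map fun w => nnRatio (Ψ w).carrier x l) :=
    Measure.isProbabilityMeasure_map hm.aemeasurable
  refine Measure.ext_of_Ici _ _ fun u => ?_
  have h1 := h.measure_forall_le_nnRatio hΨ hΛ hd hc x {l} (by simpa using hl) fun _ => u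
  rw [Finset.prod_singleton] at h1
  rw [Measure.map_apply hm measurableSet_Ici, ← h1]
  congr 1
  ext w
  simp

theorem IsPoissonProcess.iIndepFun_nnRatio (hΨ : Measurable Ψ)
    (h : IsPoissonProcess (fun w => (Ψ w).carrier) Λ P) (hΛ : HasBallVolume Λ d c) (hd : d ≠ 0)
    (hc : 0 < c) (x : M) (L : ℕ) :
    iIndepFun (fun (l : Finset.Icc 2 L) w => nnRatio (Ψ w).carrier x l) P := by
  classical
  have hm : ∀ l : ℕ, Measurable fun w => nnRatio (Ψ w).carrier x l :=
    fun l => measurable_nnRatio hΨ measurable_const l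
  refine iIndepSets.iIndep (fun l => (hm l).comap_le)
    (fun l : Finset.Icc 2 L => {t | ∃ s ∈ Set.range (Set.Ici : ℝ → Set ℝ),
      (fun w => nnRatio (Ψ w).carrier x l) ⁻¹' s = t})
    (fun l => isPiSystem_Ici.comap _) (fun l => ?_) ?_
  · refine Eq.trans (congrArg (MeasurableSpace.comap _)
      (BorelSpace.measurable_eq.trans (borel_eq_generateFrom_Ici ℝ))) ?_
    rw [MeasurableSpace.comap_generateFrom]
    rfl
  rw [iIndepSets_iff]
  intro s f hf
  have hu : ∀ l : Finset.Icc 2 L, ∃ u : ℝ, l ∈ s →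
      f l = {w | nnRatio (Ψ w).carrier x l ∈ Set.Ici u} := by
    intro l
    by_cases hl : l ∈ s
    · obtain ⟨_, ⟨u, rfl⟩, hu⟩ := hf l hl
      exact ⟨u, fun _ => hu.symm⟩
    · exact ⟨0, fun h => absurd h hl⟩
  choose u hu using hu
  have hl2 : ∀ l : Finset.Icc 2 L, 2 ≤ (l : ℕ) := fun l => (Finset.mem_Icc.1 l.2).1
  set v : ℕ → ℝ := fun l => if hl : l ∈ Finset.Icc 2 L then u ⟨l, hl⟩ else 0
  have hv : ∀ l : Finset.Icc 2 L, v l = u l := fun l => by simp only [v, dif_pos l.2]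
  have h1 := h.measure_forall_le_nnRatio hΨ hΛ hd hc x (s.map (.subtype _))
    (by
      intro l hl
      obtain ⟨l', -, rfl⟩ := Finset.mem_map.1 hl
      exact hl2 l') v
  rw [Finset.prod_map] at h1
  have h2 : ⋂ l ∈ s, f l = {w | ∀ l ∈ s.map (.subtype _),
      nnRatio (Ψ w).carrier x l ∈ Set.Ici (v l)} := by
    ext w
    simp only [Set.mem_iInter, Set.mem_ofPred_eq, Finset.forall_mem_map]
    refine forall₂_congr fun l hl => ?_
    rw [hu l hl]
    simp only [Function.Embedding.subtype_apply, hv]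
    rfl
  rw [h2, h1]
  refine Finset.prod_congr rfl fun l hl => ?_
  rw [hu l hl, (h.hasLaw_nnRatio hΨ hΛ hd hc x (hl2 l)).measure_eq
    (p := fun t => t ∈ Set.Ici (u l)) measurableSet_Ici]
  simp only [Function.Embedding.subtype_apply, hv]
  rfl

theorem IsPoissonProcess.measure_forall_nnRatio_mem (hΨ : Measurable Ψ)
    (h : IsPoissonProcess (fun w => (Ψ w).carrier) Λ P) (hΛ : HasBallVolume Λ d c) (hd : d ≠ 0)
    (hc : 0 < c) (x : M) {L : ℕ} {A : ℕ → Set ℝ} (hA : ∀ l, MeasurableSet (A l)) {s : Finset ℕ}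
    (hs : s ⊆ Finset.Icc 2 L) :
    P {w | ∀ l ∈ s, nnRatio (Ψ w).carrier x l ∈ A l} =
      ∏ l ∈ s, paretoMeasure 1 (((l : ℝ) - 1) * d) (A l) := by
  classical
  have h1 := (h.iIndepFun_nnRatio hΨ hΛ hd hc x L).measure_inter_preimage_eq_mul
    (s.subtype (· ∈ Finset.Icc 2 L)) (sets := fun l => A l) fun l _ => hA l
  rw [Finset.prod_subtype_of_mem
    (fun l => P ((fun w => nnRatio (Ψ w).carrier x l) ⁻¹' A l)) fun l hl => hs hl] at h1
  have h2 : {w | ∀ l ∈ s, nnRatio (Ψ w).carrier x l ∈ A l} =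
      ⋂ l ∈ s.subtype (· ∈ Finset.Icc 2 L), (fun w => nnRatio (Ψ w).carrier x l) ⁻¹' A l := by
    ext w
    simp only [Set.mem_ofPred_eq, Set.mem_iInter, Finset.mem_subtype, Subtype.forall]
    exact ⟨fun hw l _ hl => hw l hl, fun hw l hl => hw l (hs hl) hl⟩
  rw [h2, h1]
  exact Finset.prod_congr rfl fun l hl => (h.hasLaw_nnRatio hΨ hΛ hd hc x
    (Finset.mem_Icc.1 (hs hl)).1).measure_eq (hA l)

/-- If a property of the neighbours of `x` has the same probability `p` around every fixed
location `x`, then this is also its Palm probability. -/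
theorem IsPoissonProcess.typicalPointProb_eq (hΨ : Measurable Ψ)
    (h : IsPoissonProcess (fun w => (Ψ w).carrier) Λ P) (hae : ∀ᵐ w ∂P, (Ψ w).carrier = Φ w)
    (hΛ : HasBallVolume Λ d c) {E : Set M → M → Prop}
    (hE : MeasurableSet {q : M × Config M | E q.2.carrier q.1})
    (hE_sdiff : ∀ S x, E (S \ {x}) x ↔ E S x) {p : ℝ≥0∞}
    (hp : ∀ x, P {w | E (Ψ w).carrier x} = p) {B : Set M} (hB : MeasurableSet B)
    (hB0 : Λ B ≠ 0) (hBtop : Λ B ≠ ∞) : typicalPointProb P Φ B E = p := by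
  have := hΛ.sigmaFinite
  have hnum : ∫⁻ w, ({x ∈ Φ w ∩ B | E (Φ w) x}.encard : ℝ≥0∞) ∂P = p * Λ B := by
    set t : Set (M × Config M) := {q | q.1 ∈ B ∧ E q.2.carrier q.1}
    have ht : MeasurableSet t := (measurable_fst hB).inter hE
    have h1 := h.mecke hΨ ht
    have h2 : ∫⁻ z, P {w | (z, Ψ w) ∈ t} ∂Λ = p * Λ B := by
      rw [← lintegral_indicator_const hB]
      refine lintegral_congr fun z => ?_
      by_cases hz : z ∈ B
      · rw [Set.indicator_of_mem hz, ← hp z]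
        simp [t, hz]
      · simp [t, hz]
    rw [← h2, ← h1]
    refine lintegral_congr_ae ?_
    filter_upwards [hae] with w hw
    rw [Config.counting_setOf, ← hw]
    congr 2
    ext z
    change ((z ∈ (Ψ w).carrier ∧ z ∈ B) ∧ E (Ψ w).carrier z) ↔
      (z ∈ (Ψ w).carrier ∧ z ∈ B ∧ E ((Ψ w).carrier \ {z}) z)
    rw [hE_sdiff, and_assoc]
  have hden : ∫⁻ w, ((Φ w ∩ B).encard : ℝ≥0∞) ∂P = Λ B := by
    rw [← h.lintegral_counting hΨ hB]
    refine lintegral_congr_ae ?_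
    filter_upwards [hae] with w hw
    rw [Config.counting_apply _ hB, hw]
  rw [typicalPointProb, hnum, hden, ENNReal.mul_div_cancel_right hB0 hBtop]

end Main

end NearestNeighbour

/-- Law and joint independence of the ratios of consecutive nearest-neighbour distances in a
homogeneous Poisson process, both around an arbitrary fixed location `x` and around a typical
point of the process itself. -/
theorem theorem2
    {M : Type*} [MetricSpace M] [SecondCountableTopology M] [MeasurableSpace M] [BorelSpace M]
    {Ω : Type*} [MeasurableSpace Ω] (P : Measure Ω) [IsProbabilityMeasure P]
    (vol : Measure M) (d : ℕ) (hd : 1 ≤ d) (ω : ℝ) (hω : 0 < ω)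
    (hvol : NearestNeighbour.HasBallVolume vol d ω)
    (ρ : ℝ≥0) (hρ : 0 < ρ)
    (Φ : Ω → Set M) (hΦ : NearestNeighbour.IsPoissonProcess Φ (ρ • vol) P)
    (L : ℕ) :
    (∀ x : M,
      (∀ l ∈ Finset.Icc 2 L,
        HasLaw (fun w => NearestNeighbour.nnRatio (Φ w) x l)
          (paretoMeasure 1 (((l : ℝ) - 1) * d)) P) ∧
      iIndepFun (fun (l : Finset.Icc 2 L) w => NearestNeighbour.nnRatio (Φ w) x l) P) ∧
    (∀ B : Set M, MeasurableSet B → vol B ≠ 0 → vol B ≠ ∞ →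
      (∀ l ∈ Finset.Icc 2 L, ∀ A : Set ℝ, MeasurableSet A →
        NearestNeighbour.typicalPointProb P Φ B
            (fun S x => NearestNeighbour.nnRatio S x l ∈ A) =
          paretoMeasure 1 (((l : ℝ) - 1) * d) A) ∧
      (∀ A : ℕ → Set ℝ, (∀ l, MeasurableSet (A l)) → ∀ s ⊆ Finset.Icc 2 L,
        NearestNeighbour.typicalPointProb P Φ B
            (fun S x => ∀ l ∈ s, NearestNeighbour.nnRatio S x l ∈ A l) =
          ∏ l ∈ s, NearestNeighbour.typicalPointProb P Φ B
            (fun S x => NearestNeighbour.nnRatio S x l ∈ A l))) := by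
  classical
  have hd0 : d ≠ 0 := by omega
  have hc : 0 < (ρ : ℝ) * ω := mul_pos (by exact_mod_cast hρ) hω
  have hΛ : NearestNeighbour.HasBallVolume (ρ • vol) d (ρ * ω) := by
    intro x r hr
    rw [Measure.smul_apply, hvol x r hr, mul_assoc, ENNReal.ofReal_mul ρ.coe_nonneg,
      ENNReal.ofReal_coe_nnreal]
    rfl
  refine ⟨fun x => ?_, fun B hB hB0 hBtop => ?_⟩
  · obtain ⟨Ψ, hΨ, hae⟩ := hΦ.exists_config hΛ x
    have h := hΦ.congr hΨ hae
    have hr : ∀ l, (fun w => NearestNeighbour.nnRatio (Ψ w).carrier x l) =ᵐ[P]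
        fun w => NearestNeighbour.nnRatio (Φ w) x l := by
      intro l
      filter_upwards [hae] with w hw
      rw [hw]
    exact ⟨fun l hl => (h.hasLaw_nnRatio hΨ hΛ hd0 hc x (Finset.mem_Icc.1 hl).1).congr (hr l).symm,
      (h.iIndepFun_nnRatio hΨ hΛ hd0 hc x L).congr fun l => hr l⟩
  · obtain ⟨x₀, -⟩ := nonempty_of_measure_ne_zero hB0
    obtain ⟨Ψ, hΨ, hae⟩ := hΦ.exists_config hΛ x₀
    have h := hΦ.congr hΨ hae
    have hρB : (ρ • vol) B = (ρ : ℝ≥0∞) * vol B := rfl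
    have hρB0 : (ρ • vol) B ≠ 0 := by
      rw [hρB]
      exact mul_ne_zero (by exact_mod_cast hρ.ne') hB0
    have hρBtop : (ρ • vol) B ≠ ∞ := by
      rw [hρB]
      exact ENNReal.mul_ne_top ENNReal.coe_ne_top hBtop
    have hjoint : ∀ A : ℕ → Set ℝ, (∀ l, MeasurableSet (A l)) → ∀ s ⊆ Finset.Icc 2 L,
        NearestNeighbour.typicalPointProb P Φ B
          (fun S x => ∀ l ∈ s, NearestNeighbour.nnRatio S x l ∈ A l) =
          ∏ l ∈ s, paretoMeasure 1 (((l : ℝ) - 1) * d) (A l) := by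
      intro A hA s hs
      refine h.typicalPointProb_eq hΨ hae hΛ ?_ (fun S x => ?_)
        (fun x => h.measure_forall_nnRatio_mem hΨ hΛ hd0 hc x hA hs) hB hρB0 hρBtop
      · simp only [Set.ofPred_forall]
        exact .iInter fun l => .iInter fun _ =>
          NearestNeighbour.measurable_nnRatio measurable_snd measurable_fst l (hA l)
      · simp only [NearestNeighbour.nnRatio_sdiff_self]
    have hsingle : ∀ l ∈ Finset.Icc 2 L, ∀ A : Set ℝ, MeasurableSet A →
        NearestNeighbour.typicalPointProb P Φ B
          (fun S x => NearestNeighbour.nnRatio S x l ∈ A) =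
          paretoMeasure 1 (((l : ℝ) - 1) * d) A := by
      intro l hl A hA
      have := hjoint (fun _ => A) (fun _ => hA) {l} (Finset.singleton_subset_iff.2 hl)
      simpa only [Finset.mem_singleton, forall_eq, Finset.prod_singleton] using this
    exact ⟨hsingle, fun A hA s hs => (hjoint A hA s hs).trans
      (Finset.prod_congr rfl fun l hl => (hsingle l (hs hl) (A l) (hA l)).symm)⟩
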